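/- Let $k$ be an algebraically closed field of characteristic zero and $\mathbf i\in k$ with $\mathbf i^2=-1$. A $k$-differential ring $\mathcal R=(R,\delta)$ is a commutative $k$-algebra $R$ with a $k$-linear derivation $\delta:R\to R$; put $R_0=\ker\delta$ and $\delta^{(j)}=\delta^j/j!$. Let $\mathcal F$ be the $N=4$ Lie conformal superalgebra: the free $k[\partial]$-module on even generators $L,T^1,T^2,T^3$ and odd generators $G^1,G^2,\overline G^1,\overline G^2$, with $\lambda$-bracket $[a_\lambda b]=\sum_{n\ge 0}\frac{\lambda^n}{n!}a_{(n)}b$ determined by $[\partial a_\lambda b]=-\lambda[a_\lambda b]$, $[a_\lambda\partial b]=(\partial+\lambda)[a_\lambda b]$, skew-symmetry $[b_\lambda a]=-(-1)^{p(a)p(b)}[a_{-\lambda-\partial}b]$ ($p$ the parity) and $$[L_\lambda L]=(\partial+2\lambda)L,\quad [L_\lambda T^i]=(\partial+\lambda)T^i,\quad [L_\lambda G^p]=(\partial+\tfrac32\lambda)G^p,\quad [L_\lambda\overline G^p]=(\partial+\tfrac32\lambda)\overline G^p,$$ $$[T^i{}_\lambda T^j]=\mathbf i\sum_l\epsilon_{ijl}T^l,\quad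 [G^p{}_\lambda G^q]=[\overline G^p{}_\lambda\overline G^q]=0,\quad [T^i{}_\lambda G^p]=-\tfrac12\sum_q\sigma^i_{pq}G^q,\quad [T^i{}_\lambda\overline G^p]=\tfrac12\sum_q\sigma^i_{qp}\overline G^q,$$ $$[G^p{}_\lambda\overline G^q]=2\delta_{pq}L-2(\partial+2\lambda)\sum_i\sigma^i_{pq}T^i,$$ where $\epsilon_{ijl}$ is the Levi-Civita symbol and $\sigma^1=\begin{pmatrix}0&1\\1&0\end{pmatrix}$, $\sigma^2=\begin{pmatrix}0&-\mathbf i\\ \mathbf i&0\end{pmatrix}$, $\sigma^3=\begin{pmatrix}1&0\\0&-1\end{pmatrix}$. The base change $\mathcal F\otimes_k\mathcal R$ is $\mathcal F\otimes_kR$ with $\widehat\partial=\partial\otimes1+1\otimes\delta$ and $(a\otimes r)_{(n)}(b\otimes s)=\sum_{j\ge0}(a_{(n+j)}b)\otimes\delta^{(j)}(r)s$. Let $V$ be the $k$-span of the eight generators, and let $\mathbf{GrAut}(\mathcal F)(\mathcal R)$ be the group of automorphisms $\varphi$ of the $\mathbb Z/2$-graded $R$-module $\mathcal F\otimes_kR$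 which commute with $\widehat\partial$, preserve all $n$-th products, and satisfy $\varphi(V\otimes_kR)\subseteq V\otimes_kR$. For a morphism of $k$-differential rings $\mathcal R\to\mathcal S=(S,\delta_S)$, let $\varphi_{\mathcal S}$ be the $S$-linear extension of $\varphi$ to $\mathcal F\otimes_kS$. For $M=\begin{pmatrix}a&b\\c&d\end{pmatrix}\in R^{2\times2}$ put $G(M)=-\mathbf iG^1\otimes d-\mathbf i\overline G^1\otimes a+\mathbf iG^2\otimes b-\mathbf i\overline G^2\otimes c$, and, if $X=\begin{pmatrix}x&y\\z&-x\end{pmatrix}\in\mathfrak{sl}_2(R)$, put $T(X)=T^1\otimes(y+z)+\mathbf iT^2\otimes(y-z)+2T^3\otimes x$. For $A\in\mathbf{SL}_2(R)$ and $B\in\mathbf{SL}_2(R_0)$ let $\iota_{\mathcal R}(A,B)=\theta_{A,B}$ be the $R$-linear map on $\mathcal F\otimes_kR$ commuting with $\widehat\partial$ such that $$\theta_{A,B}(L)=L+T(\delta(A)A^{-1}),\quad\theta_{A,B}(T(X))=T(AXA^{-1}),\quad\theta_{A,B}(G(M))=G(AMB^{-1})$$ for $X\in\mathfrak{sl}_2(k)$,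 $M\in k^{2\times2}$. **Proposition.** Let $\mathcal R=(R,\delta_R)$ be a $k$-differential ring with $R$ an integral domain. For every $\varphi\in\mathbf{GrAut}(\mathcal F)(\mathcal R)$ there are a $k$-differential ring $\mathcal S=(S,\delta_S)$ and a morphism $\mathcal R\to\mathcal S$ of $k$-differential rings such that $R\to S$ is étale and faithfully flat, together with $A\in\mathbf{SL}_2(S)$ and $B\in\mathbf{SL}_2(S_0)$, $S_0=\ker\delta_S$, such that $\varphi_{\mathcal S}\in\mathbf{GrAut}(\mathcal F)(\mathcal S)$ and $$\varphi_{\mathcal S}=\theta_{A,B}=\iota_{\mathcal S}(A,B).$$ -/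

import Mathlib

universe u

open Polynomial TensorProduct

noncomputable section

namespace N4

/-- The eight free generators `L`, `T¹, T², T³`, `G¹, G²`, `Ḡ¹, Ḡ²` of the `N = 4` Lie conformal
superalgebra (indices start at `0`). -/
inductive Gen : Type
  | L : Gen
  | T : Fin 3 → Gen
  | G : Fin 2 → Gen
  | Gbar : Fin 2 → Gen
  deriving DecidableEq, Fintype

/-- Parity of a generator: `true` for the odd ones. -/
def Gen.odd : Gen → Bool
  | .L => false
  | .T _ => false
  | .G _ => true
  | .Gbar _ => true

/-- The `k[∂]`-module underlying the `N = 4` Lie conformal superalgebra `F`: it is free on the eight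
generators; the polynomial variable is `∂`. -/
abbrev F (k : Type*) [Field k] : Type _ := Gen → k[X]

section Bracket

variable {k : Type*} [Field k]

/-- The generator `g`, as an element of `F`. -/
def gen (g : Gen) : F k := Pi.single g 1

/-- The Pauli matrices, for a given square root `I` of `-1`. -/
def pauli (I : k) : Fin 3 → Matrix (Fin 2) (Fin 2) k :=
  ![!![0, 1; 1, 0], !![0, -I; I, 0], !![1, 0; 0, -1]]

/-- The sign of the cycle `(i j l)` (zero if two indices agree). -/
def eps (i j l : Fin 3) : k :=
  if (i, j, l) = (0, 1, 2) ∨ (i, j, l) = (1, 2, 0) ∨ (i, j, l) = (2, 0, 1) then 1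
  else if (i, j, l) = (0, 2, 1) ∨ (i, j, l) = (2, 1, 0) ∨ (i, j, l) = (1, 0, 2) then -1
  else 0

/-- `∂` as an element of `k[∂][λ]`. -/
def pd : k[X][X] := C X

/-- `λ` as an element of `k[∂][λ]`. -/
def lam : k[X][X] := X

/-- A constant as an element of `k[∂][λ]`. -/
def cst (c : k) : k[X][X] := C (C c)

/-- The vector with coefficient `P` at `g` and zero elsewhere. -/
def single (g : Gen) (P : k[X][X]) : Gen → k[X][X] := Pi.single g P

/-- The listed `λ`-brackets of generators: the value at `l` is the coefficient
in `k[∂][λ]` of the generator `l` in `[g_λ h]`. The pairs which are not listed get `0` here. -/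
def table (I : k) : Gen → Gen → Gen → k[X][X]
  | .L, .L => single .L (pd + 2 * lam)
  | .L, .T i => single (.T i) (pd + lam)
  | .L, .G p => single (.G p) (pd + cst (3 / 2) * lam)
  | .L, .Gbar p => single (.Gbar p) (pd + cst (3 / 2) * lam)
  | .T i, .T j => ∑ l, single (.T l) (cst (I * eps i j l))
  | .T i, .G p => ∑ q, single (.G q) (cst (-(1 / 2) * pauli I i p q))
  | .T i, .Gbar p => ∑ q, single (.Gbar q) (cst (1 / 2 * pauli I i q p))
  | .G p, .Gbar q => single .L (cst (if p = q then 2 else 0))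
      - ∑ i, single (.T i) (2 * (pd + 2 * lam) * cst (pauli I i p q))
  | _, _ => 0

/-- Substitution `λ ↦ -λ - ∂` in `k[∂][λ]`, coefficientwise. -/
def flip (v : Gen → k[X][X]) : Gen → k[X][X] := fun l => (v l).comp (-lam - pd)

/-- The `λ`-brackets `[g_λ h]` of all pairs of generators; those which are not listed in `table` are
obtained from skew-symmetry, `[h_λ g] = -(-1)^{p(g)p(h)} [g_{-λ-∂} h]`. -/
def genBracket (I : k) : Gen → Gen → Gen → k[X][X]
  | .T i, .L => -flip (table I .L (.T i))
  | .G p, .L => -flip (table I .L (.G p))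
  | .Gbar p, .L => -flip (table I .L (.Gbar p))
  | .G p, .T i => -flip (table I (.T i) (.G p))
  | .Gbar p, .T i => -flip (table I (.T i) (.Gbar p))
  | .Gbar q, .G p => flip (table I (.G p) (.Gbar q))
  | g, h => table I g h

/-- The `λ`-bracket `[a_λ b]` on `F`, as a family of coefficients in `k[∂][λ]`:
`[p(∂)g _λ q(∂)h] = p(-λ) q(∂+λ) [g_λ h]`. -/
def bracket (I : k) (a b : F k) (l : Gen) : k[X][X] :=
  ∑ g, ∑ h, aeval (-lam : k[X][X]) (a g) * aeval (pd + lam : k[X][X]) (b h) * genBracket I g h l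

/-- The `n`-th product `a_(n) b` on `F`: `n!` times the coefficient of `λⁿ` in `[a_λ b]`. -/
def nprod (I : k) (n : ℕ) : F k →ₗ[k] F k →ₗ[k] F k :=
  LinearMap.mk₂ k (fun a b l => (n.factorial : k) • (bracket I a b l).coeff n)
    (fun a a' b => by
      funext l
      simp only [bracket, Pi.add_apply, map_add, add_mul, Finset.sum_add_distrib, coeff_add,
        smul_add])
    (fun c a b => by
      funext l
      simp only [bracket, Pi.smul_apply, map_smul, smul_mul_assoc, ← Finset.smul_sum, coeff_smul]
      rw [smul_comm])
    (fun a b b' => by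
      funext l
      simp only [bracket, Pi.add_apply, map_add, mul_add, add_mul, Finset.sum_add_distrib,
        coeff_add, smul_add])
    (fun c a b => by
      funext l
      simp only [bracket, Pi.smul_apply, map_smul, smul_mul_assoc, mul_smul_comm,
        ← Finset.smul_sum, coeff_smul]
      rw [smul_comm])

/-- The even (`s = false`) and odd (`s = true`) parts of `F`. -/
def part (k : Type*) [Field k] (s : Bool) : Submodule k (F k) where
  carrier := {a | ∀ g : Gen, g.odd ≠ s → a g = 0}
  add_mem' := fun ha hb g hg => by simp [ha g hg, hb g hg]
  zero_mem' := fun _ _ => rfl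
  smul_mem' := fun c a ha g hg => by simp [ha g hg]

/-- The `k`-span `V` of the eight generators. -/
def V (k : Type*) [Field k] : Submodule k (F k) := Submodule.span k (Set.range gen)

/-- The action of `∂` on `F`. -/
def partialF (k : Type*) [Field k] : F k →ₗ[k] F k :=
  LinearMap.pi fun g => LinearMap.mulLeft k X ∘ₗ LinearMap.proj g

end Bracket

section BaseChange

variable {k : Type*} [Field k] (R : Type*) [CommRing R] [Algebra k R]

/-- The `R`-module underlying the base change of `F` to `R`. -/
abbrev FR (k : Type*) [Field k] (R : Type*) [CommRing R] [Algebra k R] : Type _ := R ⊗[k] F k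

variable {R}

/-- `δ^{(j)} = δ^j / j!`. -/
def divPow (δ : Derivation k R R) (j : ℕ) : R →ₗ[k] R :=
  (j.factorial : k)⁻¹ • (δ : R →ₗ[k] R) ^ j

/-- The action `δ ⊗ 1 + 1 ⊗ ∂` of `∂` on the base change. -/
def partialR (δ : Derivation k R R) : FR k R →ₗ[k] FR k R :=
  TensorProduct.map (δ : R →ₗ[k] R) LinearMap.id +
    TensorProduct.map LinearMap.id (partialF k)

/-- The bilinear map `(r ⊗ a, s ⊗ b) ↦ δ^{(j)}(r) s ⊗ a_(n+j) b`. -/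
def nprodTerm (I : k) (δ : Derivation k R R) (n j : ℕ) : FR k R →ₗ[k] FR k R →ₗ[k] FR k R :=
  TensorProduct.map₂ (LinearMap.mul k R ∘ₗ divPow δ j) (nprod I (n + j))

/-- The `n`-th product on the base change. The sum has finite support, see
`finite_support_nprodTerm`. -/
def nprodR (I : k) (δ : Derivation k R R) (n : ℕ) (x y : FR k R) : FR k R :=
  ∑ᶠ j : ℕ, nprodTerm I δ n j x y

theorem finite_support_nprodTerm (I : k) (δ : Derivation k R R) (n : ℕ) (x y : FR k R) :
    (Function.support fun j => nprodTerm I δ n j x y).Finite := by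
  induction x using TensorProduct.induction_on with
  | zero => simp
  | add x x' hx hx' =>
    refine (hx.union hx').subset ?_
    simpa only [map_add, LinearMap.add_apply] using Function.support_add _ _
  | tmul r a =>
    induction y using TensorProduct.induction_on with
    | zero => simp
    | add y y' hy hy' =>
      refine (hy.union hy').subset ?_
      simpa only [map_add] using Function.support_add _ _
    | tmul s b =>
      refine (Set.finite_Iic (∑ l, (bracket I a b l).natDegree)).subset fun j hj => ?_
      by_contra hlt
      apply hj
      have h0 : nprod I (n + j) a b = 0 := by
        funext l
        have : (bracket I a b l).natDegree ≤ ∑ l, (bracket I a b l).natDegree :=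
          Finset.single_le_sum (f := fun l => (bracket I a b l).natDegree)
            (fun _ _ => Nat.zero_le _) (Finset.mem_univ l)
        have hc : (bracket I a b l).coeff (n + j) = 0 :=
          coeff_eq_zero_of_natDegree_lt (by simp at hlt; omega)
        simp [nprod, hc]
      simp [nprodTerm, h0]

/-- The group of automorphisms of the `R`-conformal superalgebra `F ⊗ (R, δ)`: the automorphisms of
the `ℤ/2`-graded `R`-module which commute with `∂` and preserve all `n`-th products. -/
def Aut (I : k) (δ : Derivation k R R) : Subgroup (FR k R ≃ₗ[R] FR k R) where
  carrier := {φ | (∀ s : Bool, ((part k s).baseChange R).map (φ : FR k R →ₗ[R] FR k R)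
        = (part k s).baseChange R) ∧
      (∀ x, φ (partialR δ x) = partialR δ (φ x)) ∧
      ∀ (n : ℕ) (x y : FR k R), φ (nprodR I δ n x y) = nprodR I δ n (φ x) (φ y)}
  mul_mem' := fun {φ ψ} hφ hψ => by
    refine ⟨fun s => ?_, fun x => ?_, fun n x y => ?_⟩
    · have : ((φ * ψ : FR k R ≃ₗ[R] FR k R) : FR k R →ₗ[R] FR k R)
          = (φ : FR k R →ₗ[R] FR k R) ∘ₗ (ψ : FR k R →ₗ[R] FR k R) := rfl
      rw [this, Submodule.map_comp, hψ.1, hφ.1]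
    · simp only [LinearEquiv.mul_apply, hψ.2.1, hφ.2.1]
    · simp only [LinearEquiv.mul_apply, hψ.2.2, hφ.2.2]
  one_mem' := ⟨fun s => Submodule.map_id _, fun _ => rfl, fun _ _ _ => rfl⟩
  inv_mem' := fun {φ} hφ => by
    refine ⟨fun s => ?_, fun x => ?_, fun n x y => ?_⟩
    · conv_lhs => rw [← hφ.1 s]
      rw [← Submodule.map_comp]
      have : ((φ⁻¹ : FR k R ≃ₗ[R] FR k R) : FR k R →ₗ[R] FR k R) ∘ₗ (φ : FR k R →ₗ[R] FR k R)
          = LinearMap.id := LinearMap.ext fun x => φ.symm_apply_apply x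
      rw [this, Submodule.map_id]
    · apply φ.injective
      rw [hφ.2.1]
      exact (φ.apply_symm_apply _).trans (congrArg _ (φ.apply_symm_apply _).symm)
    · apply φ.injective
      rw [hφ.2.2]
      refine (φ.apply_symm_apply _).trans ?_
      exact congrArg₂ _ (φ.apply_symm_apply _).symm (φ.apply_symm_apply _).symm

/-- The set `GrAut(F)(R, δ)` of the automorphisms `φ` with `φ(V ⊗ R) ⊆ V ⊗ R`. -/
def GrAut (I : k) (δ : Derivation k R R) : Set (FR k R ≃ₗ[R] FR k R) :=
  {φ | φ ∈ Aut I δ ∧ ∀ x ∈ (V k).baseChange R, φ x ∈ (V k).baseChange R}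

/-- The `S`-linear extension `φ_S` of `φ`, transported along `S ⊗_R (R ⊗_k F) = S ⊗_k F`. -/
def extend (S : Type*) [CommRing S] [Algebra k S] [Algebra R S] [IsScalarTower k R S]
    (φ : FR k R ≃ₗ[R] FR k R) : FR k S ≃ₗ[S] FR k S :=
  (TensorProduct.AlgebraTensorModule.cancelBaseChange k R S S (F k)).symm ≪≫ₗ
    φ.baseChange R S _ _ ≪≫ₗ
    TensorProduct.AlgebraTensorModule.cancelBaseChange k R S S (F k)

/-- The ring of constants `R₀ = ker δ`. -/
def constants (δ : Derivation k R R) : Subalgebra k R where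
  carrier := {r | δ r = 0}
  mul_mem' := fun {a b} ha hb => by
    simp only [Set.mem_ofPred_eq] at ha hb ⊢
    simp [ha, hb]
  add_mem' := fun {a b} ha hb => by
    simp only [Set.mem_ofPred_eq] at ha hb ⊢
    simp [ha, hb]
  algebraMap_mem' := fun c => δ.map_algebraMap c

/-- `T(X)`, used for matrices `X` of trace zero. -/
def TX (I : k) (M : Matrix (Fin 2) (Fin 2) R) : FR k R :=
  (M 0 1 + M 1 0) ⊗ₜ gen (.T 0) + I • ((M 0 1 - M 1 0) ⊗ₜ gen (.T 1)) + (2 * M 0 0) ⊗ₜ gen (.T 2)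

/-- `G(M)`. -/
def GM (I : k) (M : Matrix (Fin 2) (Fin 2) R) : FR k R :=
  -(I • (M 1 1 ⊗ₜ gen (.G 0))) - I • (M 0 0 ⊗ₜ gen (.Gbar 0))
    + I • (M 0 1 ⊗ₜ gen (.G 1)) - I • (M 1 0 ⊗ₜ gen (.Gbar 1))

/-- The values of `θ_{A,B}` on the generators. Here `Tⁱ = T(σⁱ/2)`, `G¹ = G(I E₂₂)`,
`G² = G(-I E₁₂)`, `Ḡ¹ = G(I E₁₁)`, `Ḡ² = G(I E₂₁)`. -/
def thetaGen (I : k) (δ : Derivation k R R) (A : Matrix.SpecialLinearGroup (Fin 2) R)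
    (B : Matrix.SpecialLinearGroup (Fin 2) (constants δ)) : Gen → FR k R :=
  let conj (M : Matrix (Fin 2) (Fin 2) k) : Matrix (Fin 2) (Fin 2) R :=
    A.1 * M.map (algebraMap k R) * (A⁻¹).1
  let mulB (M : Matrix (Fin 2) (Fin 2) k) : Matrix (Fin 2) (Fin 2) R :=
    A.1 * M.map (algebraMap k R) * (B⁻¹).1.map (constants δ).val
  fun g => match g with
    | .L => 1 ⊗ₜ gen .L + TX I (A.1.map δ * (A⁻¹).1)
    | .T i => TX I (conj ((1 / 2 : k) • pauli I i))
    | .G p => GM I (mulB (![!![0, 0; 0, I], !![0, -I; 0, 0]] p))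
    | .Gbar p => GM I (mulB (![!![I, 0; 0, 0], !![0, 0; I, 0]] p))

/-- The `R`-linear map `θ_{A,B}` on `F ⊗ R` which commutes with `∂` and has the prescribed values on
the generators: `r ⊗ ∑ p_g(∂) g ↦ r ∑ p_g(∂)(θ_{A,B}(g))`. -/
def theta (I : k) (δ : Derivation k R R) (A : Matrix.SpecialLinearGroup (Fin 2) R)
    (B : Matrix.SpecialLinearGroup (Fin 2) (constants δ)) : FR k R →ₗ[R] FR k R :=
  LinearMap.liftBaseChange R
    (∑ g, (LinearMap.applyₗ (thetaGen I δ A B g)) ∘ₗ (aeval (partialR δ)).toLinearMap ∘ₗ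
      (LinearMap.proj g : F k →ₗ[k] k[X]))

theorem theta_gen (I : k) (δ : Derivation k R R) (A : Matrix.SpecialLinearGroup (Fin 2) R)
    (B : Matrix.SpecialLinearGroup (Fin 2) (constants δ)) (g : Gen) :
    theta I δ A B (1 ⊗ₜ gen g) = thetaGen I δ A B g := by
  simp only [theta, LinearMap.liftBaseChange_tmul, one_smul, LinearMap.sum_apply]
  rw [Finset.sum_eq_single g]
  · simp [gen]
  · intro b _ hb; simp [gen, hb]
  · simp

end BaseChange

end N4

end

/-! Since `φ` preserves `V ⊗ R` and parity, it is described by matrices: the even part of `V ⊗ R`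
consists of `r L + T(X)` with `X` of trace zero, the odd part of `G(M)` with `M` in `M₂(R)`. Three
product formulas then turn the problem into linear algebra.

The 1-product of `r L + T(X)` with `G(M)` is `(3/2) r G(M)`. Over a domain this forces `φ` to
preserve the coefficient of `L`, so `φ(L) = L + T(t)`, `φ(T(X)) = T(Φ X)` and `φ(G(M)) = G(Ψ M)`.
The 0-products `T(X)₍₀₎G(M) = G(XM)` and `L₍₀₎G(M) = ∂̂ G(M) - G(δ M)` give `Ψ(XM) = Φ(X) Ψ(M)`, and
`t Ψ(M) = δ(Ψ M)` for constant `M`. The `L`-coefficient `-4 det M` of `G(M)₍₀₎G(M)`, at `M = 1`,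
gives `det P = 1` for `P = Ψ(1)`. Hence `Θ(M) = Ψ(M) P⁻¹` is a unital multiplicative linear
endomorphism of `M₂(R)` (`exists_matrices_of_mem_GrAut`).

By an explicit Skolem–Noether argument (`exists_intertwiners`), `Θ` is intertwined with the identity
by two matrices whose determinants generate the unit ideal. Adjoining inverted square roots of these
determinants is an étale cover `S`, as 2 is a unit, and rescaling puts the intertwiners into `SL₂`
(`exists_etale_specialLinearGroup`). So `Θ(M) = A M A⁻¹` and `Ψ(M) = A M Q` over `S`, with `Q =
A⁻¹P`.

The derivation extends uniquely in effect to what is needed on an étale algebra: some extension to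
`S` exists. The equation `t A M Q = δ(A M Q)` for constant `M` then yields `t = δ(A) A⁻¹` and `δ(Q)
= 0` (`eq_logDeriv_and_map_eq_zero`). With `B = Q⁻¹`, the maps `φ_S` and `θ_{A,B}` agree on
generators and commute with `∂̂`, hence coincide. -/

noncomputable section

namespace N4

/-! ### Elementary properties of the products on the base change -/

section Products

variable {k : Type*} [Field k] {R : Type*} [CommRing R] [Algebra k R]

theorem nprodTerm_tmul (I : k) (δ : Derivation k R R) (n j : ℕ) (r s : R) (a b : F k) :
    nprodTerm I δ n j (r ⊗ₜ a) (s ⊗ₜ b) = (divPow δ j r * s) ⊗ₜ nprod I (n + j) a b := rfl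

theorem nprod_apply (I : k) (n : ℕ) (a b : F k) (l : Gen) :
    nprod I n a b l = (n.factorial : k) • (bracket I a b l).coeff n := rfl

theorem exists_nprod_eq_zero (I : k) (a b : F k) : ∃ N, ∀ n, N ≤ n → nprod I n a b = 0 := by
  refine ⟨∑ l, (bracket I a b l).natDegree + 1, fun n hn => ?_⟩
  funext l
  have : (bracket I a b l).natDegree ≤ ∑ l, (bracket I a b l).natDegree :=
    Finset.single_le_sum (f := fun l => (bracket I a b l).natDegree)
      (fun _ _ => Nat.zero_le _) (Finset.mem_univ l)
  simp [nprod_apply, coeff_eq_zero_of_natDegree_lt (show (bracket I a b l).natDegree < n by omega)]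

/-- The bound depends only on `n + j`, so one truncation serves all the products of a given pair. -/
theorem exists_nprodTerm_eq_zero (I : k) (δ : Derivation k R R) (x y : FR k R) :
    ∃ N, ∀ n j, N ≤ n + j → nprodTerm I δ n j x y = 0 := by
  induction x using TensorProduct.induction_on with
  | zero => simp
  | add x x' hx hx' =>
    obtain ⟨N, hN⟩ := hx
    obtain ⟨N', hN'⟩ := hx'
    exact ⟨max N N', fun n j h => by
      simp [hN n j (le_of_max_le_left h), hN' n j (le_of_max_le_right h)]⟩
  | tmul r a =>
    induction y using TensorProduct.induction_on with
    | zero => simp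
    | add y y' hx hx' =>
      obtain ⟨N, hN⟩ := hx
      obtain ⟨N', hN'⟩ := hx'
      exact ⟨max N N', fun n j h => by
        simp [hN n j (le_of_max_le_left h), hN' n j (le_of_max_le_right h)]⟩
    | tmul s b =>
      obtain ⟨N, hN⟩ := exists_nprod_eq_zero I a b
      exact ⟨N, fun n j h => by simp [nprodTerm_tmul, hN _ h]⟩

theorem nprodR_eq_sum_range (I : k) (δ : Derivation k R R) (n : ℕ) (x y : FR k R) (N : ℕ)
    (h : ∀ j, N ≤ j → nprodTerm I δ n j x y = 0) :
    nprodR I δ n x y = ∑ j ∈ Finset.range N, nprodTerm I δ n j x y := by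
  refine finsum_eq_sum_of_support_subset _ fun j hj => ?_
  by_contra hlt
  exact hj (h j (by simpa using hlt))

theorem nprodR_add_left (I : k) (δ : Derivation k R R) (n : ℕ) (x x' y : FR k R) :
    nprodR I δ n (x + x') y = nprodR I δ n x y + nprodR I δ n x' y := by
  simp only [nprodR, map_add, LinearMap.add_apply]
  exact finsum_add_distrib (finite_support_nprodTerm I δ n x y)
    (finite_support_nprodTerm I δ n x' y)

theorem nprodR_add_right (I : k) (δ : Derivation k R R) (n : ℕ) (x y y' : FR k R) :
    nprodR I δ n x (y + y') = nprodR I δ n x y + nprodR I δ n x y' := by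
  simp only [nprodR, map_add]
  exact finsum_add_distrib (finite_support_nprodTerm I δ n x y)
    (finite_support_nprodTerm I δ n x y')

@[simp]
theorem nprodR_zero_left (I : k) (δ : Derivation k R R) (n : ℕ) (y : FR k R) :
    nprodR I δ n 0 y = 0 := by
  simp [nprodR]

@[simp]
theorem nprodR_zero_right (I : k) (δ : Derivation k R R) (n : ℕ) (x : FR k R) :
    nprodR I δ n x 0 = 0 := by
  simp [nprodR]

theorem nprodR_tmul_of_vanishing (I : k) (δ : Derivation k R R) (n : ℕ) (r s : R) (a b : F k)
    (N : ℕ) (h : ∀ m, n + N ≤ m → nprod I m a b = 0) :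
    nprodR I δ n (r ⊗ₜ a) (s ⊗ₜ b)
      = ∑ j ∈ Finset.range N, (divPow δ j r * s) ⊗ₜ nprod I (n + j) a b :=
  nprodR_eq_sum_range I δ n _ _ N fun j hj => by
    rw [nprodTerm_tmul, h _ (by omega), tmul_zero]

@[simp]
theorem divPow_zero (δ : Derivation k R R) (r : R) : divPow δ 0 r = r := by
  simp [divPow]

theorem nprodTerm_smul_right (I : k) (δ : Derivation k R R) (n j : ℕ) (t : R) (x y : FR k R) :
    nprodTerm I δ n j x (t • y) = t • nprodTerm I δ n j x y := by
  induction x using TensorProduct.induction_on with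
  | zero => simp
  | add x x' hx hx' => simp [hx, hx']
  | tmul r a =>
    induction y using TensorProduct.induction_on with
    | zero => simp
    | add y y' hy hy' => simp [hy, hy']
    | tmul s b =>
      simp only [smul_tmul', nprodTerm_tmul, smul_eq_mul]
      rw [mul_left_comm]

theorem nprodR_smul_right (I : k) (δ : Derivation k R R) (n : ℕ) (t : R) (x y : FR k R) :
    nprodR I δ n x (t • y) = t • nprodR I δ n x y := by
  obtain ⟨N, hN⟩ := exists_nprodTerm_eq_zero I δ x y
  rw [nprodR_eq_sum_range I δ n x y N fun j hj => hN n j (by omega),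
    nprodR_eq_sum_range I δ n x (t • y) N fun j hj => by
      rw [nprodTerm_smul_right, hN n j (by omega), smul_zero], Finset.smul_sum]
  simp only [nprodTerm_smul_right]

/-- The `n`-th product is linear in the second variable. -/
def nprodRHom (I : k) (δ : Derivation k R R) (n : ℕ) (x : FR k R) : FR k R →ₗ[R] FR k R where
  toFun := nprodR I δ n x
  map_add' := nprodR_add_right I δ n x
  map_smul' t := nprodR_smul_right I δ n t x

theorem partialR_tmul (δ : Derivation k R R) (r : R) (a : F k) :
    partialR δ (r ⊗ₜ a) = δ r ⊗ₜ a + r ⊗ₜ partialF k a := rfl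

end Products

/-! ### Divided powers of a derivation -/

section Leibniz

variable {k : Type*} [Field k] [CharZero k] {R : Type*} [CommRing R] [Algebra k R]

theorem divPow_succ (δ : Derivation k R R) (j : ℕ) (r : R) :
    ((j + 1 : ℕ) : k) • divPow δ (j + 1) r = δ (divPow δ j r) := by
  have h : ((j : k) + 1) ≠ 0 := by exact_mod_cast Nat.succ_ne_zero j
  simp only [divPow, Nat.factorial_succ, Nat.cast_mul, LinearMap.smul_apply, pow_succ', smul_smul,
    Module.End.mul_apply]
  rw [mul_inv, ← mul_assoc, Nat.cast_succ, mul_inv_cancel₀ h, one_mul]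
  simp

/-- The general Leibniz rule for divided powers of a derivation. -/
theorem divPow_mul (δ : Derivation k R R) (j : ℕ) (a b : R) :
    divPow δ j (a * b)
      = ∑ p ∈ Finset.HasAntidiagonal.antidiagonal j, divPow δ p.1 a * divPow δ p.2 b := by
  induction j with
  | zero => simp
  | succ j ih =>
    have h : ((j + 1 : ℕ) : k) ≠ 0 := by exact_mod_cast Nat.succ_ne_zero j
    -- In characteristic zero it suffices to compare multiples by `j + 1`, where `(j+1) δ^{(j+1)} =
    -- δ δ^{(j)}`; on the right `j + 1` splits as `p.1 + p.2`.
    apply smul_right_injective R h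
    simp only
    rw [divPow_succ, ih, map_sum]
    simp only [Derivation.leibniz, smul_eq_mul, Finset.sum_add_distrib, ← divPow_succ]
    have key : ∀ p ∈ Finset.HasAntidiagonal.antidiagonal (j + 1),
        ((j + 1 : ℕ) : k) • (divPow δ p.1 a * divPow δ p.2 b)
          = (p.1 : k) • (divPow δ p.1 a * divPow δ p.2 b)
            + (p.2 : k) • (divPow δ p.1 a * divPow δ p.2 b) := by
      intro p hp
      rw [← add_smul, ← Nat.cast_add, Finset.HasAntidiagonal.mem_antidiagonal.1 hp]
    rw [Finset.smul_sum, Finset.sum_congr rfl key, Finset.sum_add_distrib, add_comm]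
    congr 1
    · rw [Finset.Nat.sum_antidiagonal_succ]
      simp [mul_comm]
    · rw [Finset.Nat.sum_antidiagonal_succ']
      simp

end Leibniz

/-! ### Base change of automorphisms along a differential extension -/

section Extend

theorem sum_range_antidiagonal {M : Type*} [AddCommMonoid M] (N : ℕ) (f : ℕ → ℕ → M)
    (h : ∀ i j, N ≤ i + j → f i j = 0) :
    ∑ n ∈ Finset.range N, ∑ p ∈ Finset.HasAntidiagonal.antidiagonal n, f p.1 p.2
      = ∑ i ∈ Finset.range N, ∑ j ∈ Finset.range N, f i j := by
  rw [← Finset.sum_product' (Finset.range N) (Finset.range N) f]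
  have hs : ∑ p ∈ Finset.range N ×ˢ Finset.range N with p.1 + p.2 < N, f p.1 p.2
      = ∑ p ∈ Finset.range N ×ˢ Finset.range N, f p.1 p.2 := by
    rw [Finset.sum_filter]
    refine Finset.sum_congr rfl fun p _ => ?_
    split_ifs with hp
    · rfl
    · exact (h _ _ (by omega)).symm
  rw [← hs, ← Finset.sum_fiberwise_of_maps_to (t := Finset.range N)
    (g := fun p : ℕ × ℕ => p.1 + p.2)
    (by simp)]
  refine Finset.sum_congr rfl fun n hn => Finset.sum_congr ?_ fun _ _ => rfl
  ext p
  simp only [Finset.HasAntidiagonal.mem_antidiagonal, Finset.mem_filter, Finset.mem_product,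
    Finset.mem_range] at *
  omega

variable {k : Type*} [Field k] {R : Type*} [CommRing R] [Algebra k R]
  {S : Type*} [CommRing S] [Algebra k S] [Algebra R S] [IsScalarTower k R S]

variable (S) in
/-- The canonical map `F ⊗ R → F ⊗ S`. -/
def mapFR : FR k R →ₗ[k] FR k S :=
  LinearMap.rTensor (F k) (IsScalarTower.toAlgHom k R S).toLinearMap

@[simp]
theorem mapFR_tmul (r : R) (a : F k) : mapFR S (r ⊗ₜ[k] a) = algebraMap R S r ⊗ₜ a := rfl

theorem mapFR_smul (r : R) (x : FR k R) : mapFR S (r • x) = algebraMap R S r • mapFR S x := by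
  induction x using TensorProduct.induction_on with
  | zero => simp
  | add x x' hx hx' => simp [hx, hx']
  | tmul s a =>
    rw [mapFR_tmul, smul_tmul', smul_tmul', mapFR_tmul, smul_eq_mul, smul_eq_mul, map_mul]

theorem cancelBaseChange_one_tmul (x : FR k R) :
    TensorProduct.AlgebraTensorModule.cancelBaseChange k R S S (F k) (1 ⊗ₜ x) = mapFR S x := by
  induction x using TensorProduct.induction_on with
  | zero => simp
  | add x x' hx hx' => simp [tmul_add, hx, hx']
  | tmul s a => simp [Algebra.smul_def]

theorem extend_mapFR (φ : FR k R ≃ₗ[R] FR k R) (x : FR k R) :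
    extend S φ (mapFR S x) = mapFR S (φ x) := by
  rw [← cancelBaseChange_one_tmul, ← cancelBaseChange_one_tmul, extend]
  simp

theorem extend_symm (φ : FR k R ≃ₗ[R] FR k R) : (extend S φ).symm = extend S φ.symm := rfl

/-- Induction on `F ⊗ S` through the images of `F ⊗ R`. -/
theorem mapFR_induction {p : FR k S → Prop} (h0 : p 0) (hadd : ∀ x y, p x → p y → p (x + y))
    (h : ∀ (s : S) (x : FR k R), p (s • mapFR S x)) (x : FR k S) : p x := by
  induction x using TensorProduct.induction_on with
  | zero => exact h0
  | add x x' hx hx' => exact hadd _ _ hx hx'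
  | tmul s a =>
    have := h s (1 ⊗ₜ a)
    rwa [mapFR_tmul, map_one, smul_tmul', smul_eq_mul, mul_one] at this

theorem mapFR_mem_baseChange (p : Submodule k (F k)) {x : FR k R} (hx : x ∈ p.baseChange R) :
    mapFR S x ∈ p.baseChange S := by
  rw [Submodule.baseChange_eq_span] at hx
  induction hx using Submodule.span_induction with
  | mem x hx =>
    obtain ⟨a, ha, rfl⟩ := hx
    simpa using Submodule.tmul_mem_baseChange_of_mem (1 : S) ha
  | zero => simp
  | add x y _ _ hx hy => rw [map_add]; exact add_mem hx hy
  | smul r x _ hx => rw [mapFR_smul]; exact Submodule.smul_mem _ _ hx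

theorem extend_mem_baseChange {p : Submodule k (F k)} {φ : FR k R ≃ₗ[R] FR k R}
    (h : ∀ x ∈ p.baseChange R, φ x ∈ p.baseChange R) (x : FR k S) (hx : x ∈ p.baseChange S) :
    extend S φ x ∈ p.baseChange S := by
  rw [Submodule.baseChange_eq_span] at hx
  induction hx using Submodule.span_induction with
  | mem x hx =>
    obtain ⟨a, ha, rfl⟩ := hx
    have := mapFR_mem_baseChange (S := S) p
      (h (1 ⊗ₜ a) (Submodule.tmul_mem_baseChange_of_mem (1 : R) ha))
    rw [← extend_mapFR] at this
    simpa using this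
  | zero => simp
  | add x y _ _ hx hy => rw [map_add]; exact add_mem hx hy
  | smul r x _ hx => rw [map_smul]; exact Submodule.smul_mem _ _ hx

variable {δ : Derivation k R R} {δS : Derivation k S S}

theorem partialR_smul (δ : Derivation k R R) (r : R) (x : FR k R) :
    partialR δ (r • x) = δ r • x + r • partialR δ x := by
  induction x using TensorProduct.induction_on with
  | zero => simp
  | add x x' hx hx' => simp only [smul_add, map_add, hx, hx']; abel
  | tmul s a =>
    simp only [smul_tmul', partialR_tmul, smul_eq_mul, Derivation.leibniz, add_tmul, smul_add]
    rw [mul_comm s (δ r)]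
    abel

theorem partialR_mapFR (hδ : ∀ r : R, δS (algebraMap R S r) = algebraMap R S (δ r)) (x : FR k R) :
    partialR δS (mapFR S x) = mapFR S (partialR δ x) := by
  induction x using TensorProduct.induction_on with
  | zero => simp
  | add x x' hx hx' => simp [hx, hx']
  | tmul s a => simp [partialR_tmul, hδ]

theorem extend_partialR (hδ : ∀ r : R, δS (algebraMap R S r) = algebraMap R S (δ r))
    {φ : FR k R ≃ₗ[R] FR k R} (h : ∀ x, φ (partialR δ x) = partialR δ (φ x)) (x : FR k S) :
    extend S φ (partialR δS x) = partialR δS (extend S φ x) := by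
  refine mapFR_induction (R := R)
    (p := fun x => extend S φ (partialR δS x) = partialR δS (extend S φ x))
    ?_ (fun x y hx hy => ?_) (fun s x => ?_) x
  · simp only [map_zero]
  · simp only [map_add, hx, hy]
  · simp only [partialR_smul, partialR_mapFR hδ, map_add, map_smul, extend_mapFR, h]

theorem divPow_algebraMap (hδ : ∀ r : R, δS (algebraMap R S r) = algebraMap R S (δ r))
    (j : ℕ) (r : R) : divPow δS j (algebraMap R S r) = algebraMap R S (divPow δ j r) := by
  have : ∀ j, ((δS : S →ₗ[k] S) ^ j) (algebraMap R S r)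
      = algebraMap R S (((δ : R →ₗ[k] R) ^ j) r) := by
    intro j
    induction j with
    | zero => simp
    | succ j ih => simp [pow_succ', ih, hδ]
  simp only [divPow, LinearMap.smul_apply, this, algebraMap.coe_smul]

variable [CharZero k]

/-- Products are not linear in the first variable; moving a scalar out of it costs higher products,
by the Leibniz rule for `δ^{(j)}`. The cutoff is uniform in `n` and `s`, so that the expansions for
`(x, y)` and `(φ x, φ y)` can be truncated at the same place. -/
theorem nprodR_smul_mapFR (I : k) (hδ : ∀ r : R, δS (algebraMap R S r) = algebraMap R S (δ r))
    (x y : FR k R) : ∃ N₀, ∀ N, N₀ ≤ N → ∀ (n : ℕ) (s : S),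
      nprodR I δS n (s • mapFR S x) (mapFR S y)
        = ∑ j ∈ Finset.range N, divPow δS j s • mapFR S (nprodR I δ (n + j) x y) := by
  induction x using TensorProduct.induction_on with
  | zero => simp
  | add x x' hx hx' =>
    obtain ⟨N, hN⟩ := hx
    obtain ⟨N', hN'⟩ := hx'
    exact ⟨max N N', fun M h n s => by
      simp only [map_add, smul_add, nprodR_add_left, hN M (le_of_max_le_left h),
        hN' M (le_of_max_le_right h), Finset.sum_add_distrib]⟩
  | tmul r a =>
    induction y using TensorProduct.induction_on with
    | zero => simp
    | add y y' hx hx' =>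
      obtain ⟨N, hN⟩ := hx
      obtain ⟨N', hN'⟩ := hx'
      exact ⟨max N N', fun M h n s => by
        simp only [map_add, smul_add, nprodR_add_right, hN M (le_of_max_le_left h),
          hN' M (le_of_max_le_right h), Finset.sum_add_distrib]⟩
    | tmul u b =>
      obtain ⟨N₀, hN⟩ := exists_nprod_eq_zero I a b
      refine ⟨N₀, fun N h n s => ?_⟩
      rw [mapFR_tmul, mapFR_tmul, smul_tmul', smul_eq_mul,
        nprodR_tmul_of_vanishing I δS n _ _ a b N fun m hm => hN m (by omega)]
      have hR : ∀ j, nprodR I δ (n + j) (r ⊗ₜ a) (u ⊗ₜ b)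
          = ∑ i ∈ Finset.range N, (divPow δ i r * u) ⊗ₜ nprod I (n + j + i) a b := fun j =>
        nprodR_tmul_of_vanishing I δ (n + j) _ _ a b N fun m hm => hN m (by omega)
      simp only [hR, map_sum, mapFR_tmul, Finset.smul_sum, smul_tmul', smul_eq_mul]
      -- The double sum is regrouped by total order; the terms outside the triangle vanish by the
      -- choice of `N₀`.
      rw [← sum_range_antidiagonal N (fun i j => (divPow δS i s
        * algebraMap R S (divPow δ j r * u)) ⊗ₜ[k] nprod I (n + i + j) a b)
        (fun i j hij => by rw [hN _ (by omega), tmul_zero])]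
      refine Finset.sum_congr rfl fun j _ => ?_
      rw [divPow_mul, Finset.sum_mul, sum_tmul]
      refine Finset.sum_congr rfl fun p hp => ?_
      rw [← Finset.HasAntidiagonal.mem_antidiagonal.1 hp, divPow_algebraMap hδ, map_mul,
        mul_assoc, add_assoc]

theorem extend_nprodR (I : k) (hδ : ∀ r : R, δS (algebraMap R S r) = algebraMap R S (δ r))
    {φ : FR k R ≃ₗ[R] FR k R}
    (h : ∀ (n : ℕ) (x y : FR k R), φ (nprodR I δ n x y) = nprodR I δ n (φ x) (φ y))
    (n : ℕ) (x y : FR k S) :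
    extend S φ (nprodR I δS n x y) = nprodR I δS n (extend S φ x) (extend S φ y) := by
  refine mapFR_induction (R := R) (p := fun x => extend S φ (nprodR I δS n x y)
    = nprodR I δS n (extend S φ x) (extend S φ y)) ?_ (fun x x' hx hx' => ?_) (fun s x => ?_) x
  · simp
  · simp only [map_add, nprodR_add_left, hx, hx']
  · refine mapFR_induction (R := R) (p := fun y => extend S φ (nprodR I δS n (s • mapFR S x) y)
      = nprodR I δS n (extend S φ (s • mapFR S x)) (extend S φ y))
      ?_ (fun y y' hy hy' => ?_) (fun t y => ?_) y
    · simp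
    · simp only [map_add, nprodR_add_right, hy, hy']
    · obtain ⟨N, hN⟩ := nprodR_smul_mapFR I hδ x y
      obtain ⟨N', hN'⟩ := nprodR_smul_mapFR I hδ (φ x) (φ y)
      simp only [map_smul, nprodR_smul_right, extend_mapFR, hN _ (le_max_left N N'),
        hN' _ (le_max_right N N'), map_sum, h]

theorem extend_mem_GrAut (I : k) (hδ : ∀ r : R, δS (algebraMap R S r) = algebraMap R S (δ r))
    {φ : FR k R ≃ₗ[R] FR k R} (hφ : φ ∈ GrAut I δ) : extend S φ ∈ GrAut I δS := by
  obtain ⟨⟨h1, h2, h3⟩, h4⟩ := hφ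
  refine ⟨⟨fun s => le_antisymm ?_ fun x hx => ?_, extend_partialR hδ h2, extend_nprodR I hδ h3⟩,
    extend_mem_baseChange h4⟩
  · rintro _ ⟨x, hx, rfl⟩
    refine extend_mem_baseChange (fun x hx => ?_) x hx
    rw [← h1 s]
    exact Submodule.mem_map_of_mem hx
  -- Surjectivity on each parity part comes from extending the inverse of `φ`.
  · refine ⟨extend S φ.symm x, extend_mem_baseChange (fun x hx => ?_) x hx, ?_⟩
    · rw [← h1 s] at hx
      obtain ⟨y, hy, rfl⟩ := hx
      simpa using hy
    · rw [← extend_symm]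
      exact (extend S φ).apply_symm_apply x

end Extend

/-! ### Products of generators -/

section Generators

variable {k : Type*} [Field k]

theorem bracket_gen (I : k) (g h : Gen) : bracket I (gen g) (gen h) = genBracket I g h := by
  funext l
  rw [bracket, Finset.sum_eq_single g, Finset.sum_eq_single h]
  · simp [gen]
  · intro b _ hb; simp [gen, hb]
  · simp
  · intro b _ hb; simp [gen, hb]
  · simp

theorem nprod_gen_apply (I : k) (n : ℕ) (g h l : Gen) :
    nprod I n (gen g) (gen h) l = (n.factorial : k) • (genBracket I g h l).coeff n := by
  rw [nprod_apply, bracket_gen]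

theorem gen_apply (g l : Gen) : (gen g : F k) l = if l = g then 1 else 0 := by
  rw [gen, Pi.single_apply]

theorem single_apply (g l : Gen) (P : k[X][X]) : single g P l = if l = g then P else 0 := by
  rw [single, Pi.single_apply]

theorem partialF_gen_apply (g l : Gen) : partialF k (gen g) l = if l = g then X else 0 := by
  simp [partialF, gen_apply]

/-- `[L_λ x] = (∂ + 3/2 λ) x` for the odd generators `x`. -/
theorem genBracket_L_odd (I : k) {x : Gen} (hx : x.odd = true) :
    genBracket I .L x = single x (C X + C (C (3 / 2)) * X) := by
  cases x <;> simp_all [Gen.odd, genBracket, table, pd, cst, lam]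

theorem nprod_zero_L_odd (I : k) {x : Gen} (hx : x.odd = true) :
    nprod I 0 (gen .L) (gen x) = partialF k (gen x) := by
  funext l
  rw [nprod_gen_apply, genBracket_L_odd I hx, single_apply, partialF_gen_apply]
  split_ifs <;> simp

theorem nprod_one_L_odd (I : k) {x : Gen} (hx : x.odd = true) :
    nprod I 1 (gen .L) (gen x) = (3 / 2 : k) • gen x := by
  funext l
  rw [nprod_gen_apply, genBracket_L_odd I hx, single_apply, Pi.smul_apply, gen_apply]
  split_ifs <;> simp [coeff_C, smul_eq_C_mul]

theorem nprod_L_odd_of_two_le (I : k) {x : Gen} (hx : x.odd = true) {n : ℕ} (hn : 2 ≤ n) :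
    nprod I n (gen .L) (gen x) = 0 := by
  funext l
  rw [nprod_gen_apply, genBracket_L_odd I hx, single_apply]
  have h1 : n ≠ 0 := by omega
  have h2 : 1 ≠ n := by omega
  split_ifs <;> simp [coeff_C, coeff_X, h1, h2]

theorem nprod_zero_T_G (I : k) (i : Fin 3) (p : Fin 2) :
    nprod I 0 (gen (.T i)) (gen (.G p)) = ∑ q, (-(1 / 2) * pauli I i p q) • gen (.G q) := by
  funext l
  rw [nprod_gen_apply]
  simp only [genBracket, table, Finset.sum_apply, Pi.smul_apply, single_apply, gen_apply,
    Fin.sum_univ_two, coeff_add, cst]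
  split_ifs <;> simp [smul_eq_C_mul]

theorem nprod_zero_T_Gbar (I : k) (i : Fin 3) (p : Fin 2) :
    nprod I 0 (gen (.T i)) (gen (.Gbar p)) = ∑ q, (1 / 2 * pauli I i q p) • gen (.Gbar q) := by
  funext l
  rw [nprod_gen_apply]
  simp only [genBracket, table, Finset.sum_apply, Pi.smul_apply, single_apply, gen_apply,
    Fin.sum_univ_two, coeff_add, cst]
  split_ifs <;> simp [smul_eq_C_mul]

theorem nprod_T_odd_of_pos (I : k) (i : Fin 3) {x : Gen} (hx : x.odd = true) {n : ℕ}
    (hn : 0 < n) : nprod I n (gen (.T i)) (gen x) = 0 := by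
  funext l
  rw [nprod_gen_apply]
  cases x with
  | L => simp [Gen.odd] at hx
  | T j => simp [Gen.odd] at hx
  | G p =>
    simp only [genBracket, table, Fin.sum_univ_two, Pi.add_apply, single_apply, cst]
    split_ifs <;> simp [coeff_C, hn.ne']
  | Gbar p =>
    simp only [genBracket, table, Fin.sum_univ_two, Pi.add_apply, single_apply, cst]
    split_ifs <;> simp [coeff_C, hn.ne']

/-- The coefficient of `L` in the bracket of two odd generators. -/
def pairing : Gen → Gen → k
  | .G p, .Gbar q => if p = q then 2 else 0
  | .Gbar q, .G p => if p = q then 2 else 0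
  | _, _ => 0

theorem genBracket_odd_odd_L (I : k) {x y : Gen} (hx : x.odd = true) (hy : y.odd = true) :
    genBracket I x y .L = C (C (pairing x y)) := by
  cases x <;> cases y <;>
    simp_all [Gen.odd, genBracket, table, pairing, flip, single_apply, cst]

end Generators

/-! ### Matrix coordinates on the even and odd parts of the span of generators -/

section Coordinates

variable {k : Type*} [Field k] {R : Type*} [CommRing R] [Algebra k R]

variable (R) in
/-- The constant coefficient (with respect to `∂`) of the generator `g`. -/
def coord (g : Gen) : FR k R →ₗ[R] R :=
  LinearMap.liftBaseChange R
    (Algebra.linearMap k R ∘ₗ Polynomial.lcoeff k 0 ∘ₗ (LinearMap.proj g : F k →ₗ[k] k[X]))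

@[simp]
theorem coord_tmul (g : Gen) (r : R) (a : F k) :
    coord R g (r ⊗ₜ[k] a) = r * algebraMap k R ((a g).coeff 0) := by
  simp [coord]

theorem coord_tmul_gen (g h : Gen) (r : R) :
    coord R g (r ⊗ₜ[k] gen h) = if g = h then r else 0 := by
  rw [coord_tmul, gen_apply]
  split_ifs <;> simp

theorem eq_sum_coord_of_mem {x : FR k R} (hx : x ∈ (V k).baseChange R) :
    x = ∑ g, coord R g x ⊗ₜ gen g := by
  rw [V, Submodule.baseChange_span] at hx
  induction hx using Submodule.span_induction with
  | mem x hx =>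
    obtain ⟨_, ⟨g, rfl⟩, rfl⟩ := hx
    rw [Finset.sum_eq_single g]
    · simp only [TensorProduct.mk_apply, coord_tmul_gen, if_true]
    · intro b _ hb
      simp only [TensorProduct.mk_apply, coord_tmul_gen, if_neg hb, zero_tmul]
    · simp
  | zero => simp
  | add x y _ _ hx hy =>
    conv_lhs => rw [hx, hy]
    simp only [map_add, add_tmul, Finset.sum_add_distrib]
  | smul r x _ hx =>
    conv_lhs => rw [hx]
    simp only [map_smul, Finset.smul_sum, smul_tmul']

theorem coord_eq_zero_of_mem_part {s : Bool} {x : FR k R} (hx : x ∈ (part k s).baseChange R)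
    {g : Gen} (hg : g.odd ≠ s) : coord R g x = 0 := by
  rw [Submodule.baseChange_eq_span] at hx
  induction hx using Submodule.span_induction with
  | mem x hx =>
    obtain ⟨a, ha, rfl⟩ := hx
    have : a g = 0 := ha g hg
    simp [this]
  | zero => simp
  | add x y _ _ hx hy => rw [map_add, hx, hy, add_zero]
  | smul r x _ hx => rw [map_smul, hx, smul_zero]

theorem gen_mem_V (g : Gen) : gen g ∈ V k := Submodule.subset_span ⟨g, rfl⟩

theorem gen_mem_part (g : Gen) : (gen g : F k) ∈ part k g.odd := fun h hh => by
  rw [gen_apply, if_neg (fun e => hh (by rw [e]))]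

theorem sum_gen {M : Type*} [AddCommMonoid M] (f : Gen → M) :
    ∑ g, f g = f .L + (f (.T 0) + f (.T 1) + f (.T 2)) + (f (.G 0) + f (.G 1))
      + (f (.Gbar 0) + f (.Gbar 1)) := by
  have : (Finset.univ : Finset Gen)
      = {.L, .T 0, .T 1, .T 2, .G 0, .G 1, .Gbar 0, .Gbar 1} := by decide
  rw [this]
  simp only [Finset.sum_insert, Finset.sum_singleton, Finset.mem_insert, Finset.mem_singleton,
    reduceCtorEq, Gen.T.injEq, Gen.G.injEq, Gen.Gbar.injEq, Fin.reduceEq, or_self,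
    not_false_eq_true]
  abel

theorem GM_eq (I : k) (M : Matrix (Fin 2) (Fin 2) R) :
    GM I M = (-algebraMap k R I * M 1 1) • (1 : R) ⊗ₜ[k] gen (.G 0)
      + (-algebraMap k R I * M 0 0) • (1 : R) ⊗ₜ gen (.Gbar 0)
      + (algebraMap k R I * M 0 1) • (1 : R) ⊗ₜ gen (.G 1)
      + (-algebraMap k R I * M 1 0) • (1 : R) ⊗ₜ gen (.Gbar 1) := by
  simp only [GM, smul_tmul', smul_eq_mul, mul_one, Algebra.smul_def, neg_mul, neg_tmul]
  abel

theorem TX_eq (I : k) (M : Matrix (Fin 2) (Fin 2) R) :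
    TX I M = (M 0 1 + M 1 0) • (1 : R) ⊗ₜ[k] gen (.T 0)
      + (algebraMap k R I * (M 0 1 - M 1 0)) • (1 : R) ⊗ₜ gen (.T 1)
      + (2 * M 0 0) • (1 : R) ⊗ₜ gen (.T 2) := by
  simp only [TX, smul_tmul', smul_eq_mul, mul_one, Algebra.smul_def]

/-- `G` as an `R`-linear map. -/
def GMHom (I : k) : Matrix (Fin 2) (Fin 2) R →ₗ[R] FR k R where
  toFun := GM I
  map_add' M N := by
    simp only [GM_eq, Matrix.add_apply]
    module
  map_smul' r M := by
    simp only [GM_eq, Matrix.smul_apply, RingHom.id_apply, smul_eq_mul]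
    module

theorem GMHom_apply (I : k) (M : Matrix (Fin 2) (Fin 2) R) : GMHom I M = GM I M := rfl

/-- `T` as an `R`-linear map. -/
def TXHom (I : k) : Matrix (Fin 2) (Fin 2) R →ₗ[R] FR k R where
  toFun := TX I
  map_add' M N := by
    simp only [TX_eq, Matrix.add_apply]
    module
  map_smul' r M := by
    simp only [TX_eq, Matrix.smul_apply, RingHom.id_apply, smul_eq_mul]
    module

theorem map_GM_eq_of_odd {P : Type*} [AddCommGroup P] [Module R P] {f g : FR k R →ₗ[R] P}
    (h : ∀ x : Gen, x.odd = true → f (1 ⊗ₜ gen x) = g (1 ⊗ₜ gen x)) (I : k)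
    (M : Matrix (Fin 2) (Fin 2) R) : f (GM I M) = g (GM I M) := by
  simp only [GM_eq, map_add, map_smul]
  rw [h _ rfl, h _ rfl, h _ rfl, h _ rfl]

theorem GM_injective {I : k} (hI : I ^ 2 = -1) :
    Function.Injective (GM I : Matrix (Fin 2) (Fin 2) R → FR k R) := by
  have hJ : (algebraMap k R I) ^ 2 = -1 := by rw [← map_pow, hI, map_neg, map_one]
  have hc : ∀ a b : R, algebraMap k R I * a = algebraMap k R I * b → a = b := fun a b h => by
    linear_combination -algebraMap k R I * h + (a - b) * hJ
  intro M N h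
  have key : ∀ g : Gen, coord R g (GM I M) = coord R g (GM I N) := fun g => by rw [h]
  simp only [GM_eq, map_add, map_smul, coord_tmul_gen, smul_eq_mul] at key
  have h0 := key (.G 0)
  have h1 := key (.G 1)
  have h2 := key (.Gbar 0)
  have h3 := key (.Gbar 1)
  simp at h0 h1 h2 h3
  ext i j
  fin_cases i <;> fin_cases j
  · exact hc _ _ h2
  · exact hc _ _ h1
  · exact hc _ _ h3
  · exact hc _ _ h0

theorem exists_GM_eq {I : k} (hI : I ^ 2 = -1) {x : FR k R} (hx : x ∈ (V k).baseChange R)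
    (hodd : x ∈ (part k true).baseChange R) : ∃ M, x = GM I M := by
  have hJ : (algebraMap k R I) ^ 2 = -1 := by rw [← map_pow, hI, map_neg, map_one]
  have h0 : ∀ g : Gen, g.odd = false → coord R g x = 0 := fun g hg =>
    coord_eq_zero_of_mem_part hodd (by simp [hg])
  -- These entries solve the coefficient equations of `G(M)`, using that the inverse of `I` is `-I`.
  refine ⟨!![algebraMap k R I * coord R (.Gbar 0) x, -algebraMap k R I * coord R (.G 1) x;
    algebraMap k R I * coord R (.Gbar 1) x, algebraMap k R I * coord R (.G 0) x], ?_⟩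
  conv_lhs => rw [eq_sum_coord_of_mem hx]
  rw [sum_gen, h0 _ rfl, h0 _ rfl, h0 _ rfl, h0 _ rfl, GM_eq]
  have h1 : ∀ (c : R) (a : F k), c ⊗ₜ[k] a = c • (1 : R) ⊗ₜ[k] a := fun c a => by
    rw [smul_tmul', smul_eq_mul, mul_one]
  rw [h1 _ (gen (.G 0)), h1 _ (gen (.G 1)), h1 _ (gen (.Gbar 0)), h1 _ (gen (.Gbar 1))]
  simp only [zero_tmul, Matrix.of_apply, Matrix.cons_val', Matrix.cons_val_zero,
    Matrix.cons_val_one, Matrix.cons_val_fin_one]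
  match_scalars
  · linear_combination coord R (.G 0) x * hJ
  · linear_combination coord R (.G 1) x * hJ
  · linear_combination coord R (.Gbar 0) x * hJ
  · linear_combination coord R (.Gbar 1) x * hJ

variable [CharZero k]

theorem exists_TX_eq {I : k} (hI : I ^ 2 = -1) {x : FR k R} (hx : x ∈ (V k).baseChange R)
    (heven : x ∈ (part k false).baseChange R) :
    ∃ (r : R) (M : Matrix (Fin 2) (Fin 2) R), M.trace = 0 ∧ x = r ⊗ₜ gen .L + TX I M := by
  have hJ : (algebraMap k R I) ^ 2 = -1 := by rw [← map_pow, hI, map_neg, map_one]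
  have h2 : 2 * algebraMap k R (1 / 2) = 1 := by
    rw [← map_ofNat (algebraMap k R) 2, ← map_mul]
    norm_num
  have h0 : ∀ g : Gen, g.odd = true → coord R g x = 0 := fun g hg =>
    coord_eq_zero_of_mem_part heven (by simp [hg])
  set a := coord R (.T 0) x
  set b := coord R (.T 1) x
  set c := coord R (.T 2) x
  refine ⟨coord R .L x, algebraMap k R (1 / 2) • !![c, a - algebraMap k R I * b;
    a + algebraMap k R I * b, -c], by simp [Matrix.trace_fin_two], ?_⟩
  conv_lhs => rw [eq_sum_coord_of_mem hx]
  rw [sum_gen, h0 (.G 0) rfl, h0 (.G 1) rfl, h0 (.Gbar 0) rfl, h0 (.Gbar 1) rfl, TX_eq]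
  have h1 : ∀ (c : R) (a : F k), c ⊗ₜ[k] a = c • (1 : R) ⊗ₜ[k] a := fun c a => by
    rw [smul_tmul', smul_eq_mul, mul_one]
  rw [h1 _ (gen .L), h1 _ (gen (.T 0)), h1 _ (gen (.T 1)), h1 _ (gen (.T 2))]
  simp only [zero_tmul, Matrix.of_apply, Matrix.cons_val', Matrix.cons_val_zero,
    Matrix.cons_val_one, Matrix.cons_val_fin_one, Matrix.smul_apply, smul_eq_mul]
  match_scalars
  · ring
  · linear_combination -a * h2
  · linear_combination -b * h2 + 2 * algebraMap k R (1 / 2) * b * hJ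
  · linear_combination -c * h2

end Coordinates

/-! ### Products in matrix coordinates -/

section Products

variable {k : Type*} [Field k] {R : Type*} [CommRing R] [Algebra k R]

theorem nprodR_one_L_odd (I : k) (δ : Derivation k R R) (r : R) {x : Gen} (hx : x.odd = true) :
    nprodR I δ 1 (r ⊗ₜ gen .L) (1 ⊗ₜ gen x)
      = (algebraMap k R (3 / 2) * r) • (1 : R) ⊗ₜ[k] gen x := by
  rw [nprodR_tmul_of_vanishing I δ 1 _ _ _ _ 1 fun m hm => nprod_L_odd_of_two_le I hx hm]
  rw [Finset.sum_range_one, divPow_zero, add_zero, mul_one, nprod_one_L_odd I hx, ← smul_tmul,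
    smul_tmul', smul_eq_mul, mul_one, Algebra.smul_def]

theorem nprodR_one_T_odd (I : k) (δ : Derivation k R R) (r s : R) (i : Fin 3) {x : Gen}
    (hx : x.odd = true) : nprodR I δ 1 (r ⊗ₜ gen (.T i)) (s ⊗ₜ gen x) = 0 := by
  rw [nprodR_tmul_of_vanishing I δ 1 _ _ _ _ 0 fun m hm => nprod_T_odd_of_pos I i hx (by omega)]
  simp

theorem nprodR_zero_L_odd (I : k) (δ : Derivation k R R) (s : R) {x : Gen} (hx : x.odd = true) :
    nprodR I δ 0 (1 ⊗ₜ gen .L) (s ⊗ₜ gen x) = s ⊗ₜ[k] partialF k (gen x) := by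
  rw [nprodR_tmul_of_vanishing I δ 0 _ _ _ _ 2 fun m hm =>
    nprod_L_odd_of_two_le I hx (by omega)]
  simp [Finset.sum_range_succ, divPow, nprod_zero_L_odd I hx]

theorem nprodR_zero_T_odd (I : k) (δ : Derivation k R R) (r s : R) (i : Fin 3) {x : Gen}
    (hx : x.odd = true) : nprodR I δ 0 (r ⊗ₜ gen (.T i)) (s ⊗ₜ gen x)
      = (r * s) ⊗ₜ nprod I 0 (gen (.T i)) (gen x) := by
  rw [nprodR_tmul_of_vanishing I δ 0 _ _ _ _ 1 fun m hm => nprod_T_odd_of_pos I i hx (by omega)]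
  simp

/-- The `L`-coefficient of an odd bracket has no `λ`, so the terms with derivatives of `r` do not
reach it. -/
theorem coord_L_nprodR_odd_odd (I : k) (δ : Derivation k R R) (r s : R) {x y : Gen}
    (hx : x.odd = true) (hy : y.odd = true) :
    coord R .L (nprodR I δ 0 (r ⊗ₜ gen x) (s ⊗ₜ gen y)) = r * s * algebraMap k R (pairing x y) := by
  obtain ⟨N, hN⟩ := exists_nprod_eq_zero I (gen x) (gen y)
  rw [nprodR_tmul_of_vanishing I δ 0 _ _ _ _ (N + 1) fun m hm => hN m (by omega), map_sum,
    Finset.sum_range_succ', Finset.sum_eq_zero, zero_add]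
  · simp [nprod_gen_apply, genBracket_odd_odd_L I hx hy]
  · intro j _
    simp [nprod_gen_apply, genBracket_odd_odd_L I hx hy]

theorem nprodR_one_even_GM (I : k) (δ : Derivation k R R) (r : R) (X M : Matrix (Fin 2) (Fin 2) R) :
    nprodR I δ 1 (r ⊗ₜ gen .L + TX I X) (GM I M)
      = (algebraMap k R (3 / 2) * r) • GM I M := by
  refine map_GM_eq_of_odd (f := nprodRHom I δ 1 (r ⊗ₜ gen .L + TX I X))
    (g := (algebraMap k R (3 / 2) * r) • LinearMap.id) (fun x hx => ?_) I M
  simp only [nprodRHom, LinearMap.coe_mk, AddHom.coe_mk, LinearMap.smul_apply, LinearMap.id_apply,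
    nprodR_add_left, TX, smul_tmul', nprodR_one_T_odd I δ _ _ _ hx, nprodR_one_L_odd I δ _ hx,
    add_zero]

theorem nprodR_zero_T_GM {I : k} (hI : I ^ 2 = -1) [CharZero k] (δ : Derivation k R R)
    {X : Matrix (Fin 2) (Fin 2) R} (hX : X.trace = 0) (M : Matrix (Fin 2) (Fin 2) R) :
    nprodR I δ 0 (TX I X) (GM I M) = GM I (X * M) := by
  have hJ : (algebraMap k R I) ^ 2 = -1 := by rw [← map_pow, hI, map_neg, map_one]
  have h2 : 2 * algebraMap k R (1 / 2) = 1 := by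
    rw [← map_ofNat (algebraMap k R) 2, ← map_mul]
    norm_num
  have hX' : X 1 1 = -X 0 0 := by
    rw [Matrix.trace_fin_two] at hX
    linear_combination hX
  have hG : ∀ (r s : R) (i : Fin 3) (p : Fin 2),
      nprodR I δ 0 (r • 1 ⊗ₜ gen (.T i)) (s • 1 ⊗ₜ gen (.G p))
        = ∑ q, (-(r * s * algebraMap k R (1 / 2) * algebraMap k R (pauli I i p q))) •
          (1 : R) ⊗ₜ[k] gen (.G q) := fun r s i p => by
    rw [smul_tmul', smul_tmul', nprodR_zero_T_odd I δ _ _ i rfl, nprod_zero_T_G, tmul_sum]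
    refine Finset.sum_congr rfl fun q _ => ?_
    rw [← smul_tmul, smul_tmul', Algebra.smul_def, map_mul, map_neg]
    congr 1
    simp only [smul_eq_mul]
    ring
  have hGbar : ∀ (r s : R) (i : Fin 3) (p : Fin 2),
      nprodR I δ 0 (r • 1 ⊗ₜ gen (.T i)) (s • 1 ⊗ₜ gen (.Gbar p))
        = ∑ q, (r * s * algebraMap k R (1 / 2) * algebraMap k R (pauli I i q p)) •
          (1 : R) ⊗ₜ[k] gen (.Gbar q) := fun r s i p => by
    rw [smul_tmul', smul_tmul', nprodR_zero_T_odd I δ _ _ i rfl, nprod_zero_T_Gbar, tmul_sum]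
    refine Finset.sum_congr rfl fun q _ => ?_
    rw [← smul_tmul, smul_tmul', Algebra.smul_def, map_mul]
    congr 1
    simp only [smul_eq_mul]
    ring
  rw [TX_eq, GM_eq, GM_eq]
  simp only [nprodR_add_left, nprodR_add_right, hG, hGbar, Fin.sum_univ_two]
  simp only [pauli, Matrix.cons_val_zero, Matrix.cons_val_one, Matrix.cons_val, Matrix.of_apply,
    Matrix.cons_val', Matrix.cons_val_fin_one, map_zero, map_one, map_neg, Matrix.mul_apply,
    Fin.sum_univ_two, hX']
  generalize algebraMap k R I = J at *
  generalize algebraMap k R (1 / 2) = c at *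
  clear hG hGbar hX hI
  match_scalars <;> ring_nf <;> grind

/-- On `s ⊗ x` with `x` an odd generator, `L₍₀₎` acts as `∂` on the generator alone, which is `∂̂`
minus the action of `δ` on the coefficient. -/
theorem nprodR_zero_L_GM (I : k) (δ : Derivation k R R) (M : Matrix (Fin 2) (Fin 2) R) :
    nprodR I δ 0 (1 ⊗ₜ gen .L) (GM I M) = partialR δ (GM I M) - GM I (M.map δ) := by
  have h : ∀ (s : R) {x : Gen}, x.odd = true → nprodR I δ 0 (1 ⊗ₜ gen .L) (s • 1 ⊗ₜ gen x)
      = partialR δ (s • (1 : R) ⊗ₜ[k] gen x) - δ s • (1 : R) ⊗ₜ[k] gen x := fun s x hx => by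
    simp only [smul_tmul', smul_eq_mul, mul_one, nprodR_zero_L_odd I δ s hx, partialR_tmul]
    abel
  simp only [GM_eq, nprodR_add_right, map_add]
  rw [h _ rfl, h _ rfl, h _ rfl, h _ rfl]
  simp only [Derivation.leibniz, map_neg, neg_mul, Derivation.map_algebraMap, smul_eq_mul,
    mul_zero, add_zero, Matrix.map_apply]
  abel

/-- The pairing matches `G^p` with `Ḡ^p` only, so the result is a quadratic form in `M`; the
normalization of `G(M)` makes it a multiple of the determinant. -/
theorem coord_L_nprodR_GM_GM {I : k} (hI : I ^ 2 = -1) (δ : Derivation k R R)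
    (M : Matrix (Fin 2) (Fin 2) R) :
    coord R .L (nprodR I δ 0 (GM I M) (GM I M)) = -4 * M.det := by
  have hJ : (algebraMap k R I) ^ 2 = -1 := by rw [← map_pow, hI, map_neg, map_one]
  simp only [GM_eq, nprodR_add_right, nprodR_add_left, map_add, smul_tmul', smul_eq_mul, mul_one]
  simp only [coord_L_nprodR_odd_odd I δ _ _ (show Gen.odd (.G _) = true from rfl)
    (show Gen.odd (.G _) = true from rfl), coord_L_nprodR_odd_odd I δ _ _
    (show Gen.odd (.Gbar _) = true from rfl)
    (show Gen.odd (.G _) = true from rfl), coord_L_nprodR_odd_odd I δ _ _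
    (show Gen.odd (.G _) = true from rfl)
    (show Gen.odd (.Gbar _) = true from rfl), coord_L_nprodR_odd_odd I δ _ _
    (show Gen.odd (.Gbar _) = true from rfl)
    (show Gen.odd (.Gbar _) = true from rfl)]
  simp [pairing]
  rw [map_ofNat (algebraMap k R) 2]
  rw [Matrix.det_fin_two]
  linear_combination 4 * (M 0 0 * M 1 1 - M 0 1 * M 1 0) * hJ

end Products

/-! ### The square of `G(1)` -/

section Constant

variable {k : Type*} [Field k] {R : Type*} [CommRing R] [Algebra k R]

theorem divPow_one_eq_zero (δ : Derivation k R R) {j : ℕ} (hj : j ≠ 0) :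
    divPow δ j (1 : R) = 0 := by
  obtain ⟨j, rfl⟩ := Nat.exists_eq_succ_of_ne_zero hj
  simp [divPow, pow_succ]

theorem nprodR_one_tmul (I : k) (δ : Derivation k R R) (n : ℕ) (s : R) (a b : F k) :
    nprodR I δ n (1 ⊗ₜ a) (s ⊗ₜ b) = s ⊗ₜ nprod I n a b := by
  obtain ⟨N, hN⟩ := exists_nprod_eq_zero I a b
  rw [nprodR_tmul_of_vanishing I δ n _ _ a b (N + 1) fun m hm => hN m (by omega),
    Finset.sum_range_succ', Finset.sum_eq_zero, zero_add]
  · simp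
  · intro j _
    rw [divPow_one_eq_zero δ j.succ_ne_zero, zero_mul, zero_tmul]

/-- The substitution `λ ↦ -λ - ∂` changes the sign of `∂ + 2λ`, so the `T`-terms of the two orders
cancel. Thus `G(1)₍₀₎G(1)` is exactly a multiple of `L`, to which `φ` can be applied. -/
theorem nprod_zero_G_Gbar (I : k) :
    nprod I 0 (gen (.G 0)) (gen (.Gbar 0)) + nprod I 0 (gen (.Gbar 0)) (gen (.G 0))
      = (4 : k) • gen .L := by
  funext l
  rw [Pi.add_apply, nprod_gen_apply, nprod_gen_apply, Pi.smul_apply, gen_apply]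
  simp only [genBracket, table, flip, Pi.sub_apply, Pi.add_apply, Fin.sum_univ_three, single_apply,
    cst, pd, lam, pauli]
  rcases l with _ | i | p | p
  · simp [smul_eq_C_mul]
    rw [← C_add]
    norm_num
  · fin_cases i <;> (simp [mul_add]; try ring)
  · simp
  · simp

theorem nprod_zero_G_G (I : k) (p q : Fin 2) : nprod I 0 (gen (.G p)) (gen (.G q)) = 0 := by
  funext l
  simp [nprod_gen_apply, genBracket, table]

theorem nprod_zero_Gbar_Gbar (I : k) (p q : Fin 2) :
    nprod I 0 (gen (.Gbar p)) (gen (.Gbar q)) = 0 := by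
  funext l
  simp [nprod_gen_apply, genBracket, table]

theorem nprodR_zero_GM_one {I : k} (hI : I ^ 2 = -1) (δ : Derivation k R R) :
    nprodR I δ 0 (GM I 1) (GM I 1) = (-4 : R) • (1 : R) ⊗ₜ[k] gen .L := by
  have h1 : GM I (1 : Matrix (Fin 2) (Fin 2) R) = 1 ⊗ₜ (-I • (gen (.G 0) + gen (.Gbar 0))) := by
    simp [GM, tmul_add, tmul_neg, ← tmul_smul]
    abel
  rw [h1, nprodR_one_tmul]
  have h2 : nprod I 0 (-I • (gen (.G 0) + gen (.Gbar 0))) (-I • (gen (.G 0) + gen (.Gbar 0)))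
      = (-4 : k) • gen .L := by
    simp only [map_smul, LinearMap.smul_apply, map_add, LinearMap.add_apply, nprod_zero_G_G,
      nprod_zero_Gbar_Gbar, zero_add, add_zero]
    rw [← smul_add, add_comm, nprod_zero_G_Gbar, smul_smul, smul_smul]
    congr 1
    linear_combination 4 * hI
  rw [h2, ← smul_tmul, smul_tmul', Algebra.smul_def, map_neg, map_ofNat, smul_eq_mul]

end Constant

/-! ### The matrix data of an automorphism -/

section Matrices

variable {k : Type*} [Field k] {R : Type*} [CommRing R] [Algebra k R]

theorem gen_tmul_mem_V (g : Gen) (r : R) : r ⊗ₜ[k] gen g ∈ (V k).baseChange R :=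
  Submodule.tmul_mem_baseChange_of_mem r (gen_mem_V g)

theorem gen_tmul_mem_part (g : Gen) (r : R) : r ⊗ₜ[k] gen g ∈ (part k g.odd).baseChange R :=
  Submodule.tmul_mem_baseChange_of_mem r (gen_mem_part g)

theorem GM_mem (I : k) (M : Matrix (Fin 2) (Fin 2) R) :
    GM I M ∈ (V k).baseChange R ⊓ (part k true).baseChange R := by
  have h : ∀ (g : Gen), g.odd = true →
      (1 : R) ⊗ₜ[k] gen g ∈ (V k).baseChange R ⊓ (part k true).baseChange R :=
    fun g hg => ⟨gen_tmul_mem_V g 1, hg ▸ gen_tmul_mem_part g 1⟩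
  rw [GM_eq]
  exact add_mem (add_mem (add_mem (Submodule.smul_mem _ _ (h _ rfl))
    (Submodule.smul_mem _ _ (h _ rfl))) (Submodule.smul_mem _ _ (h _ rfl)))
    (Submodule.smul_mem _ _ (h _ rfl))

theorem TX_mem (I : k) (M : Matrix (Fin 2) (Fin 2) R) :
    TX I M ∈ (V k).baseChange R ⊓ (part k false).baseChange R := by
  have h : ∀ (g : Gen), g.odd = false →
      (1 : R) ⊗ₜ[k] gen g ∈ (V k).baseChange R ⊓ (part k false).baseChange R :=
    fun g hg => ⟨gen_tmul_mem_V g 1, hg ▸ gen_tmul_mem_part g 1⟩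
  rw [TX_eq]
  exact add_mem (add_mem (Submodule.smul_mem _ _ (h _ rfl))
    (Submodule.smul_mem _ _ (h _ rfl))) (Submodule.smul_mem _ _ (h _ rfl))

variable {I : k} {δ : Derivation k R R} {φ : FR k R ≃ₗ[R] FR k R}

theorem apply_mem_of_mem_GrAut (hφ : φ ∈ GrAut I δ) {s : Bool} {x : FR k R}
    (hx : x ∈ (V k).baseChange R ⊓ (part k s).baseChange R) :
    φ x ∈ (V k).baseChange R ⊓ (part k s).baseChange R :=
  ⟨hφ.2 x hx.1, by
    rw [← hφ.1.1 s]
    exact Submodule.mem_map_of_mem hx.2⟩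

theorem nprodR_one_odd_of_mem_GrAut (hφ : φ ∈ GrAut I δ) {r r' : R}
    {X Y M N : Matrix (Fin 2) (Fin 2) R} (hX : φ (r ⊗ₜ gen .L + TX I X) = r' ⊗ₜ gen .L + TX I Y)
    (hM : φ (GM I M) = GM I N) :
    (algebraMap k R (3 / 2) * r) • GM I N = (algebraMap k R (3 / 2) * r') • GM I N := by
  have h := hφ.1.2.2 1 (r ⊗ₜ gen .L + TX I X) (GM I M)
  rwa [nprodR_one_even_GM, hX, hM, nprodR_one_even_GM, map_smul, hM] at h

variable [CharZero k]

/-- The coefficient of `L` is read off from the eigenvalue of the 1-product on the image of `G(1)`.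
That image is `G(N)` with `N ≠ 0`, so a nonzero entry can be cancelled in the domain. -/
theorem L_coeff_eq_of_mem_GrAut [IsDomain R] (hI : I ^ 2 = -1) (hφ : φ ∈ GrAut I δ) {r r' : R}
    {X Y : Matrix (Fin 2) (Fin 2) R}
    (hX : φ (r ⊗ₜ gen .L + TX I X) = r' ⊗ₜ gen .L + TX I Y) : r' = r := by
  have hm := apply_mem_of_mem_GrAut hφ (GM_mem I (1 : Matrix (Fin 2) (Fin 2) R))
  obtain ⟨N, hN⟩ := exists_GM_eq hI hm.1 hm.2
  have h := nprodR_one_odd_of_mem_GrAut hφ hX hN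
  simp only [← GMHom_apply, ← map_smul] at h
  have h' := GM_injective hI h
  have hN0 : N ≠ 0 := fun e => by
    rw [e, ← GMHom_apply I 0, map_zero, LinearEquiv.map_eq_zero_iff] at hN
    exact one_ne_zero (GM_injective hI (hN.trans (map_zero (GMHom (R := R) I)).symm))
  have h3 : algebraMap k R (3 / 2) ≠ 0 := by
    rw [Ne, map_eq_zero_iff _ (algebraMap k R).injective]
    norm_num
  obtain ⟨i, j, hij⟩ : ∃ i j, N i j ≠ 0 := by
    by_contra! hc
    exact hN0 (Matrix.ext hc)
  have := congrFun (congrFun h' i) j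
  simp only [Matrix.smul_apply, smul_eq_mul] at this
  exact (mul_left_cancel₀ h3 (mul_right_cancel₀ hij this)).symm

/-- An automorphism of `M₂(R)` together with the remaining data which describes an element of
`GrAut` on the generators. -/
theorem exists_matrices_of_mem_GrAut [IsDomain R] (hI : I ^ 2 = -1) (hφ : φ ∈ GrAut I δ) :
    ∃ (t : Matrix (Fin 2) (Fin 2) R)
      (Θ : Matrix (Fin 2) (Fin 2) R →ₗ[R] Matrix (Fin 2) (Fin 2) R)
      (P : Matrix (Fin 2) (Fin 2) R),
      t.trace = 0 ∧ P.det = 1 ∧ Θ 1 = 1 ∧ (∀ X Y, Θ (X * Y) = Θ X * Θ Y) ∧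
      (∀ X, X.trace = 0 → (Θ X).trace = 0) ∧
      φ (1 ⊗ₜ gen .L) = 1 ⊗ₜ gen .L + TX I t ∧
      (∀ X, X.trace = 0 → φ (TX I X) = TX I (Θ X)) ∧
      (∀ M, φ (GM I M) = GM I (Θ M * P)) ∧
      ∀ M, M.map δ = 0 → t * (Θ M * P) = (Θ M * P).map δ := by
  have hT0 : TX I (0 : Matrix (Fin 2) (Fin 2) R) = 0 := map_zero (TXHom I)
  obtain ⟨t, ht, htL⟩ : ∃ t : Matrix (Fin 2) (Fin 2) R, t.trace = 0 ∧
      φ (1 ⊗ₜ gen .L) = 1 ⊗ₜ gen .L + TX I t := by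
    have hm := apply_mem_of_mem_GrAut hφ (s := false)
      ⟨gen_tmul_mem_V .L (1 : R), gen_tmul_mem_part .L (1 : R)⟩
    obtain ⟨r, t, ht, h⟩ := exists_TX_eq hI hm.1 hm.2
    refine ⟨t, ht, ?_⟩
    rw [h, L_coeff_eq_of_mem_GrAut hI hφ (X := 0) (r := 1) (r' := r) (Y := t)
      (by rw [hT0, add_zero, h])]
  have hΦ : ∀ X : Matrix (Fin 2) (Fin 2) R, ∃ Y : Matrix (Fin 2) (Fin 2) R, Y.trace = 0 ∧
      φ (TX I X) = TX I Y := fun X => by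
    have hm := apply_mem_of_mem_GrAut hφ (TX_mem I X)
    obtain ⟨r, Y, hY, h⟩ := exists_TX_eq hI hm.1 hm.2
    refine ⟨Y, hY, ?_⟩
    rw [h, L_coeff_eq_of_mem_GrAut hI hφ (X := X) (r := 0) (r' := r) (Y := Y)
      (by rw [zero_tmul, zero_add, h]), zero_tmul, zero_add]
  have hΨ : ∀ M : Matrix (Fin 2) (Fin 2) R, ∃ N : Matrix (Fin 2) (Fin 2) R,
      φ (GM I M) = GM I N := fun M => by
    have hm := apply_mem_of_mem_GrAut hφ (GM_mem I M)
    exact exists_GM_eq hI hm.1 hm.2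
  choose Φ hΦ0 hΦ using hΦ
  choose Ψ' hΨ' using hΨ
  obtain ⟨Ψ, hΨ⟩ : ∃ Ψ : Matrix (Fin 2) (Fin 2) R →ₗ[R] Matrix (Fin 2) (Fin 2) R,
      ∀ M, φ (GM I M) = GM I (Ψ M) := by
    -- Injectivity of `G` makes the chosen values `R`-linear.
    refine ⟨⟨⟨Ψ', fun M N => GM_injective hI ?_⟩, fun r M => GM_injective hI ?_⟩, hΨ'⟩
    · simp only [← hΨ', ← GMHom_apply, map_add]
      simp only [GMHom_apply, hΨ']
    · simp only [← hΨ', ← GMHom_apply, map_smul, RingHom.id_apply]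
      simp only [GMHom_apply, hΨ']
  have hΨmul : ∀ X M, X.trace = 0 → Ψ (X * M) = Φ X * Ψ M := fun X M hX => by
    have h := hφ.1.2.2 0 (TX I X) (GM I M)
    rw [nprodR_zero_T_GM hI δ hX, hΦ, hΨ, hΨ, nprodR_zero_T_GM hI δ (hΦ0 X)] at h
    exact GM_injective hI h
  have hΨδ : ∀ M, M.map δ = 0 → t * Ψ M = (Ψ M).map δ := fun M hM => by
    have h := hφ.1.2.2 0 (1 ⊗ₜ gen .L) (GM I M)
    rw [nprodR_zero_L_GM, hM, htL, nprodR_add_left, hΨ, nprodR_zero_L_GM,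
      nprodR_zero_T_GM hI δ ht, map_sub, hφ.1.2.1, hΨ, hΨ, map_zero] at h
    refine GM_injective hI ?_
    have h0 : GM I (0 : Matrix (Fin 2) (Fin 2) R) = 0 := map_zero (GMHom I)
    rw [h0, sub_zero] at h
    rw [sub_add_eq_add_sub, eq_sub_iff_add_eq] at h
    exact (add_left_cancel h).symm
  -- Comparing `L`-coefficients in the image of `G(1)₍₀₎G(1) = -4 L` gives `-4 = -4 det Ψ(1)`.
  have hdet : (Ψ 1).det = 1 := by
    have h := congrArg (coord R .L) (hφ.1.2.2 0 (GM I 1) (GM I 1))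
    rw [nprodR_zero_GM_one hI, map_smul, htL, hΨ, coord_L_nprodR_GM_GM hI, TX_eq] at h
    simp only [map_add, map_smul, coord_tmul_gen, smul_eq_mul, reduceCtorEq, if_true, if_false,
      mul_zero, add_zero] at h
    have h4 : (4 : R) ≠ 0 := by
      rw [← map_ofNat (algebraMap k R) 4, Ne, map_eq_zero_iff _ (algebraMap k R).injective]
      norm_num
    exact (mul_left_cancel₀ (neg_ne_zero.2 h4) h).symm
  have h2 : algebraMap k R (1 / 2) * 2 = 1 := by
    rw [← map_ofNat (algebraMap k R) 2, ← map_mul]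
    norm_num
  set P := Ψ 1
  have hPP : P * P.adjugate = 1 := by rw [Matrix.mul_adjugate, hdet, one_smul]
  have hPP' : P.adjugate * P = 1 := by rw [Matrix.adjugate_mul, hdet, one_smul]
  set Θ : Matrix (Fin 2) (Fin 2) R →ₗ[R] Matrix (Fin 2) (Fin 2) R :=
    LinearMap.mulRight R P.adjugate ∘ₗ Ψ
  have hΘ : ∀ M, Θ M = Ψ M * P.adjugate := fun M => rfl
  have hΘP : ∀ M, Θ M * P = Ψ M := fun M => by
    rw [hΘ, Matrix.mul_assoc, hPP', Matrix.mul_one]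
  have hΘ1 : Θ 1 = 1 := hPP
  have hΘΦ : ∀ X, X.trace = 0 → Θ X = Φ X := fun X hX => by
    have := hΨmul X 1 hX
    rw [Matrix.mul_one] at this
    rw [hΘ, this, Matrix.mul_assoc, hPP, Matrix.mul_one]
  refine ⟨t, Θ, P, ht, hdet, hΘ1, fun X Y => ?_, fun X hX => ?_, htL, fun X hX => ?_,
    fun M => ?_, fun M hM => ?_⟩
  -- Multiplicativity is known for a left factor of trace zero; subtracting the scalar part of `X`
  -- suffices because `Θ 1 = 1`.
  · have h0 : (X - (algebraMap k R (1 / 2) * X.trace) • 1).trace = 0 := by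
      rw [Matrix.trace_sub, Matrix.trace_smul, Matrix.trace_one, Fintype.card_fin, smul_eq_mul]
      push_cast
      linear_combination -X.trace * h2
    have h1 : Θ ((X - (algebraMap k R (1 / 2) * X.trace) • 1) * Y)
        = Θ (X - (algebraMap k R (1 / 2) * X.trace) • 1) * Θ Y := by
      rw [hΘΦ _ h0, hΘ, hΘ Y, hΨmul _ _ h0, Matrix.mul_assoc]
    simpa only [Matrix.sub_mul, Matrix.smul_mul, Matrix.one_mul, map_sub, map_smul, hΘ1,
      sub_left_inj] using h1
  · rw [hΘΦ X hX]
    exact hΦ0 X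
  · rw [hΘΦ X hX]
    exact hΦ X
  · rw [hΘP]
    exact hΨ M
  · rw [hΘP]
    exact hΨδ M hM

end Matrices

/-! ### Étale covers by square roots -/

section SquareRoots

variable {R : Type u} [CommRing R]

/-- The standard étale algebra which adjoins an invertible square root of `d`. -/
def sqrtPair (h d : R) (h2 : 2 * h = 1) : StandardEtalePair R where
  f := X ^ 2 - C d
  monic_f := monic_X_pow_sub_C d two_ne_zero
  g := X
  -- The derivative of `X² - d` times `h` is `2hX = X`, the first power of `g`.
  cond := ⟨C h, 0, 1, by
    have : (C (2 * h) : R[X]) = 1 := by rw [h2, C_1]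
    simp only [derivative_sub, derivative_X_pow, derivative_C, map_mul] at this ⊢
    push_cast
    simp only [map_ofNat] at this ⊢
    linear_combination X * this⟩

theorem sqrtPair_hasMap_iff {h d : R} (h2 : 2 * h = 1) {S : Type*} [CommRing S] [Algebra R S]
    {x : S} : (sqrtPair h d h2).HasMap x ↔ x ^ 2 = algebraMap R S d ∧ IsUnit x := by
  simp [StandardEtalePair.HasMap, sqrtPair, sub_eq_zero]

/-- If `d₁, …, dₙ` generate the unit ideal, there is an étale cover on the pieces of which the
`dᵢ` become squares of units. -/
theorem faithfullyFlat_pi_sqrtPair {n : ℕ} {h : R} (h2 : 2 * h = 1) (d : Fin n → R)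
    (hd : Ideal.span (Set.range d) = ⊤) :
    Module.FaithfullyFlat R (∀ i, (sqrtPair h (d i) h2).Ring) := by
  refine (Module.FaithfullyFlat.iff_flat_and_proper_ideal R _).2 ⟨inferInstance, fun J hJ hJS => ?_⟩
  obtain ⟨m, hm, hJm⟩ := Ideal.exists_le_maximal J hJ
  obtain ⟨i, hi⟩ : ∃ i, d i ∉ m := by
    by_contra! hc
    refine hm.ne_top (top_le_iff.1 (hd ▸ Ideal.span_le.2 ?_))
    rintro _ ⟨i, rfl⟩
    exact hc i
  let _ := Ideal.Quotient.field m
  let K := AlgebraicClosure (R ⧸ m)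
  obtain ⟨x, hx⟩ := IsAlgClosed.exists_pow_nat_eq (algebraMap R K (d i)) two_pos
  have hker : ∀ r : R, algebraMap R K r = 0 ↔ r ∈ m := fun r => by
    rw [IsScalarTower.algebraMap_apply R (R ⧸ m) K, map_eq_zero, Ideal.Quotient.algebraMap_eq,
      Ideal.Quotient.eq_zero_iff_mem]
  have hx0 : x ≠ 0 := fun e => hi ((hker _).1 (by rw [← hx, e]; simp))
  -- A geometric point above `m`: it exists because `d i` is nonzero modulo `m` and has a square
  -- root in `K`. It kills `J` but not 1, so `J` does not generate the unit ideal.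
  let f : (∀ i, (sqrtPair h (d i) h2).Ring) →ₐ[R] K :=
    ((sqrtPair h (d i) h2).lift x ((sqrtPair_hasMap_iff h2).2 ⟨hx, hx0.isUnit⟩)).comp
      (Pi.evalAlgHom R _ i)
  have hle : J • (⊤ : Submodule R (∀ i, (sqrtPair h (d i) h2).Ring)) ≤
      LinearMap.ker f.toLinearMap := by
    refine Submodule.smul_le.2 fun r hr s _ => ?_
    rw [LinearMap.mem_ker, map_smul, Algebra.smul_def, (hker r).2 (hJm hr), zero_mul]
  have : f.toLinearMap 1 = 0 := hle (hJS.symm ▸ Submodule.mem_top (x := 1))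
  rw [AlgHom.toLinearMap_apply, map_one] at this
  exact one_ne_zero this

/-- Intertwiners whose determinants generate the unit ideal become proportional to elements of
`SL₂` over an étale cover. -/
theorem exists_etale_specialLinearGroup {n : ℕ} {h : R} (h2 : 2 * h = 1)
    (Z : Fin n → Matrix (Fin 2) (Fin 2) R)
    (hZ : Ideal.span (Set.range fun i => (Z i).det) = ⊤) :
    ∃ (S : Type u) (_ : CommRing S) (_ : Algebra R S), Algebra.Etale R S ∧
      Module.FaithfullyFlat R S ∧ ∃ A : Matrix.SpecialLinearGroup (Fin 2) S,
        ∀ M N : Matrix (Fin 2) (Fin 2) R, (∀ i, N * Z i = Z i * M) →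
          N.map (algebraMap R S) * A.1 = A.1 * M.map (algebraMap R S) := by
  have hu := fun i => (sqrtPair_hasMap_iff h2).1 (sqrtPair h (Z i).det h2).hasMap_X
  choose hsq hunit using hu
  choose y hy using fun i => (hunit i).exists_right_inv
  -- On the `i`-th factor, `A` is `Z i` divided by the adjoined square root of its determinant.
  let A : Matrix (Fin 2) (Fin 2) (∀ i, (sqrtPair h (Z i).det h2).Ring) :=
    Matrix.of fun a b i => y i * algebraMap R _ (Z i a b)
  have hA : A.det = 1 := by
    funext i
    have := congrArg (algebraMap R (sqrtPair h (Z i).det h2).Ring) (Matrix.det_fin_two (Z i))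
    rw [← hsq i] at this
    simp only [Matrix.det_fin_two, A, Matrix.of_apply, Pi.sub_apply, Pi.mul_apply, Pi.one_apply]
    simp only [map_sub, map_mul] at this
    linear_combination -(y i) ^ 2 * this + ((sqrtPair h (Z i).det h2).X * y i + 1) * hy i
  refine ⟨∀ i, (sqrtPair h (Z i).det h2).Ring, inferInstance, inferInstance, inferInstance,
    faithfullyFlat_pi_sqrtPair h2 _ hZ, ⟨A, hA⟩, fun M N hMN => ?_⟩
  ext a b i
  have := congrArg (algebraMap R (sqrtPair h (Z i).det h2).Ring) (congrFun (congrFun (hMN i) a) b)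
  simp only [Matrix.mul_apply, Fin.sum_univ_two, map_add, map_mul] at this
  simp only [Matrix.mul_apply, Fin.sum_univ_two, Matrix.map_apply, A, Matrix.of_apply,
    Pi.add_apply, Pi.mul_apply, Pi.algebraMap_apply]
  linear_combination y i * this

end SquareRoots

/-! ### Derivations along étale maps -/

section Derivation

variable {k R S : Type*} [CommRing k] [CommRing R] [CommRing S] [Algebra k R] [Algebra k S]
  [Algebra R S] [IsScalarTower k R S]

/-- Derivations extend along étale ring maps. -/
theorem exists_derivation_extension [Algebra.FormallyEtale R S] (δ : Derivation k R R) :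
    ∃ δS : Derivation k S S, ∀ r, δS (algebraMap R S r) = algebraMap R S (δ r) := by
  refine ⟨((LinearMap.liftBaseChange S (Algebra.linearMap R S ∘ₗ δ.liftKaehlerDifferential)) ∘ₗ
    (KaehlerDifferential.tensorKaehlerEquivOfFormallyEtale k R S).symm.toLinearMap).compDer
    (KaehlerDifferential.D k S), fun r => ?_⟩
  change LinearMap.liftBaseChange S _ ((KaehlerDifferential.tensorKaehlerEquivOfFormallyEtale k R
    S).symm (KaehlerDifferential.D k S (algebraMap R S r))) = _
  rw [KaehlerDifferential.tensorKaehlerEquivOfFormallyEtale_symm_D_algebraMap]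
  simp

end Derivation

/-! ### Explicit Skolem–Noether for two-by-two matrices -/

section Intertwiners

variable {R : Type*} [CommRing R]

/-- Skolem–Noether for `M₂(R)`: intertwiners whose determinants generate the unit ideal. -/
theorem exists_intertwiners {h : R} (h2 : 2 * h = 1)
    (Θ : Matrix (Fin 2) (Fin 2) R →ₗ[R] Matrix (Fin 2) (Fin 2) R) (h1 : Θ 1 = 1)
    (hmul : ∀ X Y, Θ (X * Y) = Θ X * Θ Y) (htr : ∀ X, X.trace = 0 → (Θ X).trace = 0) :
    ∃ Z : Fin 2 → Matrix (Fin 2) (Fin 2) R, (∀ i M, Θ M * Z i = Z i * M) ∧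
      Ideal.span (Set.range fun i => (Z i).det) = ⊤ := by
  set e := Θ !![1, 0; 0, 0] with he
  set f := Θ !![0, 0; 1, 0] with hf
  set g := Θ !![0, 1; 0, 0] with hg
  have htre : e.trace = 1 := by
    have h3 := htr !![1, 0; 0, -1] (by simp [Matrix.trace_fin_two])
    -- Writing `E₁₁` as half of the identity plus a traceless matrix determines the trace of its
    -- image.
    have h4 : (!![1, 0; 0, 0] : Matrix (Fin 2) (Fin 2) R) = h • (1 + !![1, 0; 0, -1]) := by
      ext i j
      fin_cases i <;> fin_cases j <;> simp
      linear_combination -h2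
    rw [he, h4, map_smul, map_add, h1, Matrix.trace_smul, Matrix.trace_add, h3, Matrix.trace_one]
    simp
    linear_combination h2
  have hge : g * e = 0 := by
    rw [hg, he, ← hmul, ← map_zero Θ]
    congr 1
    ext i j
    fin_cases i <;> fin_cases j <;> simp
  have hgf : g * f = e := by
    rw [hg, hf, he, ← hmul]
    congr 1
    ext i j
    fin_cases i <;> fin_cases j <;> simp
  -- The columns of `Z u` are the `u`-th columns of `Θ(E₁₁)` and `Θ(E₂₁)`. Left multiplication by
  -- `Θ(M)` acts on them as `M` acts on the basis `E₁₁, E₂₁` of a left ideal.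
  refine ⟨fun u => !![e 0 u, f 0 u; e 1 u, f 1 u], fun u M => ?_, ?_⟩
  · have hM : ∀ M : Matrix (Fin 2) (Fin 2) R, Θ M * e = M 0 0 • e + M 1 0 • f := fun M => by
      rw [he, hf, ← hmul, ← map_smul Θ, ← map_smul Θ, ← map_add Θ]
      congr 1
      ext i j
      fin_cases i <;> fin_cases j <;> simp [Matrix.mul_apply]
    have hM' : ∀ M : Matrix (Fin 2) (Fin 2) R, Θ M * f = M 0 1 • e + M 1 1 • f := fun M => by
      rw [he, hf, ← hmul, ← map_smul Θ, ← map_smul Θ, ← map_add Θ]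
      congr 1
      ext i j
      fin_cases i <;> fin_cases j <;> simp [Matrix.mul_apply]
    have k1 := fun i => congrFun (congrFun (hM M) i) u
    have k2 := fun i => congrFun (congrFun (hM' M) i) u
    simp only [Matrix.mul_apply, Fin.sum_univ_two, Matrix.add_apply, Matrix.smul_apply,
      smul_eq_mul] at k1 k2
    ext i j
    fin_cases i <;> fin_cases j <;> simp [Matrix.mul_apply]
    · linear_combination k1 0
    · linear_combination k2 0
    · linear_combination k1 1
    · linear_combination k2 1
  · rw [Ideal.eq_top_iff_one]
    have m0 := Ideal.subset_span (α := R) (Set.mem_range_self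
      (f := fun u : Fin 2 => (!![e 0 u, f 0 u; e 1 u, f 1 u] : Matrix (Fin 2) (Fin 2) R).det) 0)
    have m1 := Ideal.subset_span (α := R) (Set.mem_range_self
      (f := fun u : Fin 2 => (!![e 0 u, f 0 u; e 1 u, f 1 u] : Matrix (Fin 2) (Fin 2) R).det) 1)
    have a := fun i j => congrFun (congrFun hge i) j
    have b := fun i j => congrFun (congrFun hgf i) j
    simp only [Matrix.mul_apply, Fin.sum_univ_two, Matrix.zero_apply] at a b
    rw [Matrix.trace_fin_two] at htre
    -- The relations `g e = 0` and `g f = e` give `g₀₁ det Z₀ = e₀₀²` and `-g₁₀ det Z₁ = e₁₁²`. The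
    -- cofactors come from `a²(a + 3b) + b²(b + 3a) = (a + b)³`, with `a + b = tr e = 1`.
    have key := add_mem (Ideal.mul_mem_left _ (g 0 1 * (e 0 0 + 3 * e 1 1)) m0)
      (Ideal.mul_mem_left _ (-g 1 0 * (e 1 1 + 3 * e 0 0)) m1)
    convert key using 1
    simp only [Matrix.det_fin_two_of]
    have q0 : g 0 1 * (e 0 0 * f 1 0 - f 0 0 * e 1 0) = e 0 0 ^ 2 := by
      linear_combination e 0 0 * b 0 0 - f 0 0 * a 0 0
    have q1 : -g 1 0 * (e 0 1 * f 1 1 - f 0 1 * e 1 1) = e 1 1 ^ 2 := by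
      linear_combination e 1 1 * b 1 1 - f 1 1 * a 1 1
    linear_combination -(e 0 0 + 3 * e 1 1) * q0 - (e 1 1 + 3 * e 0 0) * q1
      - ((e 0 0 + e 1 1) ^ 2 + (e 0 0 + e 1 1) + 1) * htre

end Intertwiners

/-! ### Logarithmic derivatives and constant matrices -/

section Matrices

variable {k : Type*} [Field k] {R : Type*} [CommRing R] [Algebra k R]

theorem map_derivation_mul {m : Type*} [Fintype m] (δ : Derivation k R R) (M N : Matrix m m R) :
    (M * N).map δ = M.map δ * N + M * N.map δ := by
  ext i j
  simp only [Matrix.map_apply, Matrix.mul_apply, Matrix.add_apply, map_sum, Derivation.leibniz,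
    smul_eq_mul, ← Finset.sum_add_distrib]
  exact Finset.sum_congr rfl fun _ _ => by ring

theorem trace_adjugate_mul_map_derivation (δ : Derivation k R R) (M : Matrix (Fin 2) (Fin 2) R) :
    (M.adjugate * M.map δ).trace = δ M.det := by
  rw [Matrix.adjugate_fin_two, Matrix.det_fin_two, Matrix.trace_fin_two]
  simp [Matrix.mul_apply, Fin.sum_univ_two]
  ring

theorem map_derivation_map_algebraMap {m : Type*} (δ : Derivation k R R) (M : Matrix m m k) :
    (M.map (algebraMap k R)).map δ = 0 := by
  ext i j
  simp

/-- Commuting with `E₁₁` kills the off-diagonal entries, commuting with `E₁₂` equates the diagonal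
ones, and their sum is zero with 2 invertible. -/
theorem eq_zero_of_commute_of_trace_eq_zero {h : R} (h2 : 2 * h = 1) {W : Matrix (Fin 2) (Fin 2) R}
    (hW : W.trace = 0)
    (hc : ∀ M : Matrix (Fin 2) (Fin 2) k, Commute W (M.map (algebraMap k R))) : W = 0 := by
  have h1 := fun i j => congrFun (congrFun (hc !![1, 0; 0, 0]).eq i) j
  have h3 := congrFun (congrFun (hc !![0, 1; 0, 0]).eq 0) 1
  have h01 := h1 0 1
  have h10 := h1 1 0
  simp [Matrix.mul_apply, Fin.sum_univ_two] at h01 h10 h3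
  rw [Matrix.trace_fin_two] at hW
  have h00 : W 0 0 = 0 := by linear_combination -W 0 0 * h2 + h * (hW + h3)
  ext i j
  fin_cases i <;> fin_cases j
  · exact h00
  · exact h01.symm
  · exact h10
  · exact h3.symm.trans h00

/-- If `t A M Q = δ(A M Q)` for all constant matrices `M`, then `t` is the logarithmic derivative
of `A` and `Q` is constant. -/
theorem eq_logDeriv_and_map_eq_zero {h : R} (h2 : 2 * h = 1) (δ : Derivation k R R)
    {t : Matrix (Fin 2) (Fin 2) R} (ht : t.trace = 0) (A Q : Matrix.SpecialLinearGroup (Fin 2) R)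
    (hδ : ∀ M : Matrix (Fin 2) (Fin 2) k, t * (A.1 * M.map (algebraMap k R) * Q.1)
      = (A.1 * M.map (algebraMap k R) * Q.1).map δ) :
    t = A.1.map δ * (A⁻¹).1 ∧ Q.1.map δ = 0 := by
  have hA : (A⁻¹).1 * A.1 = 1 := congrArg Subtype.val (inv_mul_cancel A)
  have hA' : A.1 * (A⁻¹).1 = 1 := congrArg Subtype.val (mul_inv_cancel A)
  have hQ : (Q⁻¹).1 * Q.1 = 1 := congrArg Subtype.val (inv_mul_cancel Q)
  have hQ' : Q.1 * (Q⁻¹).1 = 1 := congrArg Subtype.val (mul_inv_cancel Q)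
  -- `W` measures the failure of `t` to be `δ(A) A⁻¹`, conjugated by `A`. The hypothesis becomes `W
  -- M = M δ(Q) Q⁻¹`; at `M = 1` this identifies the two, so `W` commutes with every constant
  -- matrix.
  set W := (A⁻¹).1 * (t * A.1 - A.1.map δ) with hW
  have key : ∀ M : Matrix (Fin 2) (Fin 2) k,
      W * M.map (algebraMap k R) = M.map (algebraMap k R) * (Q.1.map δ * (Q⁻¹).1) := fun M => by
    have h := hδ M
    rw [map_derivation_mul, map_derivation_mul, map_derivation_map_algebraMap, Matrix.mul_zero,
      add_zero, ← sub_eq_iff_eq_add'] at h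
    calc W * M.map (algebraMap k R)
        = (A⁻¹).1 * (t * (A.1 * M.map (algebraMap k R) * Q.1)
          - A.1.map δ * M.map (algebraMap k R) * Q.1) * (Q⁻¹).1 := by
          simp only [hW, Matrix.mul_sub, Matrix.sub_mul, Matrix.mul_assoc, hQ', Matrix.mul_one]
      _ = ((A⁻¹).1 * A.1) * M.map (algebraMap k R) * (Q.1.map δ * (Q⁻¹).1) := by
          rw [h]
          simp only [Matrix.mul_assoc]
      _ = _ := by rw [hA, Matrix.one_mul]
  have h1 : W = Q.1.map δ * (Q⁻¹).1 := by
    have := key 1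
    rwa [Matrix.map_one _ (map_zero _) (map_one _), Matrix.mul_one, Matrix.one_mul] at this
  -- By Jacobi's formula the trace of `A⁻¹ δ(A)` is `δ(det A) = δ(1) = 0`.
  have htr : W.trace = 0 := by
    rw [hW, Matrix.mul_sub, Matrix.trace_sub, ← Matrix.mul_assoc, Matrix.trace_mul_comm,
      ← Matrix.mul_assoc, hA', Matrix.one_mul, ht, Matrix.SpecialLinearGroup.coe_inv,
      trace_adjugate_mul_map_derivation, A.2, Derivation.map_one_eq_zero, sub_zero]
  have hW0 : W = 0 := eq_zero_of_commute_of_trace_eq_zero (k := k) h2 htr fun M => by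
    rw [commute_iff_eq, key M, h1]
  constructor
  · have := congrArg (A.1 * ·) hW0
    simp only [hW, ← Matrix.mul_assoc, hA', Matrix.one_mul, Matrix.mul_zero] at this
    rw [← sub_eq_zero.1 this, Matrix.mul_assoc, hA', Matrix.mul_one]
  · have := congrArg (· * Q.1) (h1.symm.trans hW0)
    simpa only [Matrix.mul_assoc, hQ, Matrix.mul_one, Matrix.zero_mul] using this

/-- `θ_{A,B}` multiplies by `B⁻¹` on the right, so the constant matrix `Q` is realized as an
inverse. -/
theorem exists_constants_lift (δ : Derivation k R R) (Q : Matrix.SpecialLinearGroup (Fin 2) R)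
    (hQ : Q.1.map δ = 0) : ∃ B : Matrix.SpecialLinearGroup (Fin 2) (constants δ),
      (B⁻¹).1.map (constants δ).val = Q.1 := by
  have h : ∀ i j, δ (Q.1 i j) = 0 := fun i j => congrFun (congrFun hQ i) j
  let Q' : Matrix.SpecialLinearGroup (Fin 2) (constants δ) :=
    ⟨Matrix.of fun i j => ⟨Q.1 i j, h i j⟩, by
      have := Q.2
      rw [Matrix.det_fin_two] at this ⊢
      exact Subtype.ext this⟩
  exact ⟨Q'⁻¹, by rw [inv_inv]; rfl⟩

end Matrices

/-! ### Recognizing `theta` from its values on generators -/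

section Theta

variable {k : Type*} [Field k] {R : Type*} [CommRing R] [Algebra k R]

/-- Since `δ(1) = 0`, the operator `∂̂` acts on `1 ⊗ a` as `∂`, and `F` is free over `k[∂]` on the
generators. -/
theorem one_tmul_eq_sum_aeval (δ : Derivation k R R) (a : F k) :
    (1 : R) ⊗ₜ[k] a = ∑ g, aeval (partialR δ) (a g) (1 ⊗ₜ gen g) := by
  have hX : ∀ (p : k[X]) (b : F k), aeval (partialR δ) p ((1 : R) ⊗ₜ[k] b)
      = 1 ⊗ₜ aeval (partialF k) p b := fun p b => by
    induction p using Polynomial.induction_on' with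
    | add p q hp hq => simp only [map_add, LinearMap.add_apply, hp, hq, tmul_add]
    | monomial n c =>
      have hn : ∀ n : ℕ, ((partialR δ) ^ n) ((1 : R) ⊗ₜ[k] b) = 1 ⊗ₜ ((partialF k) ^ n) b := by
        intro n
        induction n with
        | zero => simp
        | succ n ih => simp [pow_succ', ih, partialR_tmul]
      simp only [aeval_monomial, Module.End.mul_apply, hn, Module.algebraMap_end_apply, tmul_smul]
  have hF : ∀ (p : k[X]) (g : Gen), aeval (partialF k) p (gen g) = Pi.single g p := fun p g => by
    induction p using Polynomial.induction_on' with
    | add p q hp hq => simp only [map_add, LinearMap.add_apply, hp, hq, Pi.single_add]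
    | monomial n c =>
      have hn : ∀ n : ℕ, ((partialF k) ^ n) (gen g) = Pi.single g (X ^ n) := by
        intro n
        induction n with
        | zero => rfl
        | succ n ih =>
          rw [pow_succ', Module.End.mul_apply, ih]
          funext l
          simp [partialF, Pi.single_apply, pow_succ']
      simp only [aeval_monomial, Module.End.mul_apply, hn, Module.algebraMap_end_apply]
      rw [← Pi.single_smul, smul_X_eq_monomial]
  simp only [hX, hF, ← tmul_sum]
  rw [Finset.univ_sum_single]

theorem eq_theta {I : k} {δ : Derivation k R R} {A : Matrix.SpecialLinearGroup (Fin 2) R}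
    {B : Matrix.SpecialLinearGroup (Fin 2) (constants δ)} {ψ : FR k R →ₗ[R] FR k R}
    (hψ : ∀ x, ψ (partialR δ x) = partialR δ (ψ x))
    (h : ∀ g, ψ (1 ⊗ₜ gen g) = thetaGen I δ A B g) : ψ = theta I δ A B := by
  have hp : ∀ (p : k[X]) (x : FR k R),
      ψ (aeval (partialR δ) p x) = aeval (partialR δ) p (ψ x) := fun p x => by
    induction p using Polynomial.induction_on' generalizing x with
    | add p q hp hq => simp only [map_add, LinearMap.add_apply, hp, hq]
    | monomial n c =>
      have hn : ∀ (n : ℕ) (x : FR k R), ψ (((partialR δ) ^ n) x) = ((partialR δ) ^ n) (ψ x) := by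
        intro n
        induction n with
        | zero => simp
        | succ n ih => intro x; simp only [pow_succ', Module.End.mul_apply, hψ, ih]
      simp only [aeval_monomial, Module.End.mul_apply, Module.algebraMap_end_apply,
        LinearMap.map_smul_of_tower, hn]
  have h1 : ∀ a : F k, ψ (1 ⊗ₜ a) = theta I δ A B (1 ⊗ₜ a) := fun a => by
    conv_lhs => rw [one_tmul_eq_sum_aeval δ]
    rw [map_sum, theta, LinearMap.liftBaseChange_tmul, one_smul, LinearMap.sum_apply]
    exact Finset.sum_congr rfl fun g _ => by rw [hp, h]; rfl
  refine LinearMap.ext fun x => ?_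
  induction x using TensorProduct.induction_on with
  | zero => simp
  | add x y hx hy => simp [hx, hy]
  | tmul r a =>
    rw [← mul_one r, ← smul_eq_mul, ← smul_tmul', map_smul, map_smul, h1]

variable {S : Type*} [CommRing S] [Algebra k S] [Algebra R S] [IsScalarTower k R S]

theorem mapFR_TX (I : k) (M : Matrix (Fin 2) (Fin 2) R) :
    mapFR S (TX I M) = TX I (M.map (algebraMap R S)) := by
  simp [TX]
  rw [map_ofNat]

theorem mapFR_GM (I : k) (M : Matrix (Fin 2) (Fin 2) R) :
    mapFR S (GM I M) = GM I (M.map (algebraMap R S)) := by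
  simp [GM]

theorem TX_pauli {I : k} (hI : I ^ 2 = -1) [CharZero k] (i : Fin 3) :
    TX I (((1 / 2 : k) • pauli I i).map (algebraMap k R)) = (1 : R) ⊗ₜ[k] gen (.T i) := by
  have hJ : (algebraMap k R I) ^ 2 = -1 := by rw [← map_pow, hI, map_neg, map_one]
  have h2 : 2 * algebraMap k R (1 / 2) = 1 := by
    rw [← map_ofNat (algebraMap k R) 2, ← map_mul]
    norm_num
  rw [TX_eq]
  simp only [Matrix.map_apply, Matrix.smul_apply, smul_eq_mul, map_mul]
  generalize algebraMap k R (1 / 2) = c at *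
  fin_cases i <;> simp [pauli]
  · match_scalars
    linear_combination h2
  · match_scalars
    linear_combination h2 - 2 * c * hJ
  · match_scalars
    linear_combination h2

theorem trace_pauli (I : k) (i : Fin 3) :
    (((1 / 2 : k) • pauli I i).map (algebraMap k R)).trace = 0 := by
  fin_cases i <;> simp [pauli, Matrix.trace_fin_two]

theorem GM_G {I : k} (hI : I ^ 2 = -1) (p : Fin 2) :
    GM I ((![!![0, 0; 0, I], !![0, -I; 0, 0]] p : Matrix (Fin 2) (Fin 2) k).map (algebraMap k R))
      = (1 : R) ⊗ₜ[k] gen (.G p) := by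
  have hJ : (algebraMap k R I) * algebraMap k R I = -1 := by
    rw [← pow_two, ← map_pow, hI, map_neg, map_one]
  rw [GM_eq]
  fin_cases p <;> simp [hJ]

theorem GM_Gbar {I : k} (hI : I ^ 2 = -1) (p : Fin 2) :
    GM I ((![!![I, 0; 0, 0], !![0, 0; I, 0]] p : Matrix (Fin 2) (Fin 2) k).map (algebraMap k R))
      = (1 : R) ⊗ₜ[k] gen (.Gbar p) := by
  have hJ : (algebraMap k R I) * algebraMap k R I = -1 := by
    rw [← pow_two, ← map_pow, hI, map_neg, map_one]
  rw [GM_eq]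
  fin_cases p <;> simp [hJ]

end Theta

end N4

end

/-! ### Descent of the matrix data to `A` and `B` over the étale cover -/

theorem mainTheorem4 {k : Type*} [Field k] [IsAlgClosed k] [CharZero k] (I : k) (hI : I ^ 2 = -1)
    {R : Type u} [CommRing R] [IsDomain R] [Algebra k R] (δ : Derivation k R R)
    (φ : N4.FR k R ≃ₗ[R] N4.FR k R) (hφ : φ ∈ N4.GrAut I δ) :
    ∃ (S : Type u) (_ : CommRing S) (_ : Algebra k S) (_ : Algebra R S) (_ : IsScalarTower k R S)
      (δS : Derivation k S S),
      (∀ r : R, δS (algebraMap R S r) = algebraMap R S (δ r)) ∧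
      Algebra.Etale R S ∧ Module.FaithfullyFlat R S ∧
      ∃ (A : Matrix.SpecialLinearGroup (Fin 2) S)
        (B : Matrix.SpecialLinearGroup (Fin 2) (N4.constants δS)),
        N4.extend S φ ∈ N4.GrAut I δS ∧
        (N4.extend S φ : N4.FR k S →ₗ[S] N4.FR k S) = N4.theta I δS A B := by
  obtain ⟨t, Θ, P, ht, hP, hΘ1, hΘmul, hΘtr, hL, hT, hG, hδ⟩ :=
    N4.exists_matrices_of_mem_GrAut hI hφ
  have h2 : 2 * algebraMap k R (1 / 2) = 1 := by
    rw [← map_ofNat (algebraMap k R) 2, ← map_mul]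
    norm_num
  obtain ⟨Z, hZ, hspan⟩ := N4.exists_intertwiners h2 Θ hΘ1 hΘmul hΘtr
  obtain ⟨S, _, _, hEtale, hFlat, A, hA⟩ := N4.exists_etale_specialLinearGroup h2 Z hspan
  let _ : Algebra k S := ((algebraMap R S).comp (algebraMap k R)).toAlgebra
  have _ : IsScalarTower k R S := IsScalarTower.of_algebraMap_eq fun _ => rfl
  obtain ⟨δS, hδS⟩ := N4.exists_derivation_extension (k := k) (S := S) δ
  have hAA : A.1 * (A⁻¹).1 = 1 := congrArg Subtype.val (mul_inv_cancel A)
  have hΘA : ∀ M, (Θ M).map (algebraMap R S) = A.1 * M.map (algebraMap R S) * (A⁻¹).1 := fun M => by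
    rw [← hA M (Θ M) fun i => hZ i M, Matrix.mul_assoc, hAA, Matrix.mul_one]
  -- From `Ψ(M) = Θ(M) P = A M A⁻¹ P`, the right-hand factor is `A⁻¹ P`.
  let Q : Matrix.SpecialLinearGroup (Fin 2) S :=
    A⁻¹ * Matrix.SpecialLinearGroup.map (algebraMap R S) ⟨P, hP⟩
  have hQ : Q.1 = (A⁻¹).1 * P.map (algebraMap R S) := rfl
  have hΘP : ∀ M, (Θ M * P).map (algebraMap R S) = A.1 * M.map (algebraMap R S) * Q.1 :=
    fun M => by rw [Matrix.map_mul, hΘA, hQ, Matrix.mul_assoc _ (A⁻¹).1]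
  have hkR : ∀ M : Matrix (Fin 2) (Fin 2) k,
      (M.map (algebraMap k R)).map (algebraMap R S) = M.map (algebraMap k S) := fun M => rfl
  have hmap : ∀ M : Matrix (Fin 2) (Fin 2) R,
      (M.map (algebraMap R S)).map δS = (M.map δ).map (algebraMap R S) := fun M => by
    ext i j
    exact hδS _
  have h2S : 2 * algebraMap R S (algebraMap k R (1 / 2)) = 1 := by
    rw [← map_ofNat (algebraMap R S) 2, ← map_mul, h2, map_one]
  obtain ⟨htA, hQδ⟩ := N4.eq_logDeriv_and_map_eq_zero h2S δS (t := t.map (algebraMap R S))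
    (by
      have := congrArg (algebraMap R S) ht
      simpa [Matrix.trace_fin_two] using this) A Q fun M => by
      rw [← hkR, ← hΘP, ← Matrix.map_mul, hmap, hδ _ (N4.map_derivation_map_algebraMap δ M)]
  obtain ⟨B, hB⟩ := N4.exists_constants_lift δS Q hQδ
  refine ⟨S, inferInstance, inferInstance, inferInstance, inferInstance, δS, hδS, hEtale, hFlat, A,
    B, N4.extend_mem_GrAut I hδS hφ, N4.eq_theta (N4.extend_partialR hδS hφ.1.2.1) fun g => ?_⟩
  -- The generators over `S` come from `R`, where the action of `φ` is known.
  have hgen : (1 : S) ⊗ₜ[k] N4.gen g = N4.mapFR S ((1 : R) ⊗ₜ[k] N4.gen g) := by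
    rw [N4.mapFR_tmul, map_one]
  rw [LinearEquiv.coe_coe, hgen, N4.extend_mapFR]
  rcases g with _ | i | p | p
  · rw [hL, map_add, N4.mapFR_TX, N4.mapFR_tmul, map_one, htA]
    rfl
  · rw [← N4.TX_pauli hI, hT _ (N4.trace_pauli I i), N4.mapFR_TX, hΘA, hkR]
    rfl
  · rw [← N4.GM_G hI, hG, N4.mapFR_GM, hΘP, hkR, ← hB]
    rfl
  · rw [← N4.GM_Gbar hI, hG, N4.mapFR_GM, hΘP, hkR, ← hB]
    rfl
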